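/- Let $b_\pm>0$, $c>0$ and $\delta_\pm\in\mathbb R$ with $b_\pm+\delta_\pm>0$. Define $$b_n=\begin{cases}b_+,&n\ge 0\\ b_-,&n\le -1,\end{cases}\qquad c_n=\begin{cases}b_++\delta_+,&n\ge 0\\ c,&n=-1\\ b_-+\delta_-,&n\le -2,\end{cases}\qquad d_n=\begin{cases}b_++\delta_+,&n\ge 0\\ c,&n=-1,-2\\ b_-+\delta_-,&n\le -3.\end{cases}$$ For $k\in\mathbb R$ let $\widehat H_{\mathrm{II}}(k)$ be the operator on $\ell^2(\mathbb Z;\mathbb C^6)$ (the Floquet–Bloch Hamiltonian with quasi-momentum $k$ of the nearest-neighbour tight-binding model with a type-II, or armchair, interface) given, for $\mathbf w=\{(w_{j,n})_{j=1}^6\}_{n\in\mathbb Z}$, by $$\begin{aligned} (\widehat H_{\mathrm{II}}(k)\mathbf w)_{1,n}&=-b_nw_{4,n}-b_nw_{5,n}-c_ne^{-ik}w_{6,n+1},\\ (\widehat H_{\mathrm{II}}(k)\mathbf w)_{2,n}&=-b_nw_{4,n}-d_{n-2}e^{ik}w_{5,n-2}-b_nw_{6,n},\\ (\widehat H_{\mathrm{II}}(k)\mathbf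 w)_{3,n}&=-c_nw_{4,n+1}-b_nw_{5,n}-b_nw_{6,n},\\ (\widehat H_{\mathrm{II}}(k)\mathbf w)_{4,n}&=-b_nw_{1,n}-b_nw_{2,n}-c_{n-1}w_{3,n-1},\\ (\widehat H_{\mathrm{II}}(k)\mathbf w)_{5,n}&=-b_nw_{1,n}-d_ne^{-ik}w_{2,n+2}-b_nw_{3,n},\\ (\widehat H_{\mathrm{II}}(k)\mathbf w)_{6,n}&=-c_{n-1}e^{ik}w_{1,n-1}-b_nw_{2,n}-b_nw_{3,n}. \end{aligned}$$ If $\delta_+\delta_-<0$, then there is a nonzero real constant $E^{(1)}_{\mathrm{II}}$, depending only on $(b_\pm,\delta_\pm,c)$, such that for all sufficiently small nonzero $|k|$ the operator $\widehat H_{\mathrm{II}}(k)$ has two distinct real eigenvalues $E_{\mathrm{II},-}(k)$ and $E_{\mathrm{II},+}(k)$, and $$E_{\mathrm{II},\pm}(k)=\pm E^{(1)}_{\mathrm{II}}\,|k|+\mathcal O(k^2)\qquad(k\to 0,\ k\ne 0).$$ -/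

import Mathlib

open Filter Topology Asymptotics

noncomputable section

namespace TypeII

/-- The parameters `(b₊, b₋, δ₊, δ₋, c)` of the interface (data only; their signs are hypotheses
of the theorem). -/
structure Params where
  bPlus : ℝ
  bMinus : ℝ
  δPlus : ℝ
  δMinus : ℝ
  c : ℝ

/-- Intracell hopping coefficient `b_n`. -/
def hopB (p : Params) (n : ℤ) : ℝ :=
  if 0 ≤ n then p.bPlus else p.bMinus

/-- Intercell hopping coefficient `c_n` (joining cells `n` and `n + 1`). -/
def hopC (p : Params) (n : ℤ) : ℝ :=
  if 0 ≤ n then p.bPlus + p.δPlus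
  else if n = -1 then p.c
  else p.bMinus + p.δMinus

/-- Intercell hopping coefficient `d_n` (joining cells `n` and `n + 2`). -/
def hopD (p : Params) (n : ℤ) : ℝ :=
  if 0 ≤ n then p.bPlus + p.δPlus
  else if n = -1 ∨ n = -2 then p.c
  else p.bMinus + p.δMinus

/-- The Hilbert space `ℓ²(ℤ; ℂ⁶)`; the components `1, …, 6` are indexed by `0, …, 5`.
A sequence `φ` stands for the `k`-quasiperiodic wave function `ψ_{j,m,n} = e^{ikm} φ_{j,n}`. -/
abbrev Space : Type :=
  lp (fun _ : ℤ => EuclideanSpace ℂ (Fin 6)) 2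

/-- `e^{ik}`. -/
def phase (k : ℝ) : ℂ := Complex.exp (Complex.I * k)

/-- The Bloch Hamiltonian of the type-II interface as a difference expression. -/
def hamFun (p : Params) (k : ℝ) (w : ℤ → EuclideanSpace ℂ (Fin 6)) (n : ℤ) :
    EuclideanSpace ℂ (Fin 6) :=
  !₂[-(hopB p n : ℂ) * w n 3 - (hopB p n : ℂ) * w n 4
        - (hopC p n : ℂ) * phase (-k) * w (n + 1) 5,
     -(hopB p n : ℂ) * w n 3 - (hopD p (n - 2) : ℂ) * phase k * w (n - 2) 4
        - (hopB p n : ℂ) * w n 5,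
     -(hopC p n : ℂ) * w (n + 1) 3 - (hopB p n : ℂ) * w n 4 - (hopB p n : ℂ) * w n 5,
     -(hopB p n : ℂ) * w n 0 - (hopB p n : ℂ) * w n 1
        - (hopC p (n - 1) : ℂ) * w (n - 1) 2,
     -(hopB p n : ℂ) * w n 0 - (hopD p n : ℂ) * phase (-k) * w (n + 2) 1
        - (hopB p n : ℂ) * w n 2,
     -(hopC p (n - 1) : ℂ) * phase k * w (n - 1) 0 - (hopB p n : ℂ) * w n 1
        - (hopB p n : ℂ) * w n 2]

theorem memℓp_iff_coord (w : ℤ → EuclideanSpace ℂ (Fin 6)) :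
    Memℓp w 2 ↔ ∀ j, Memℓp (fun n => w n j) 2 := by
  have h2 : (0 : ℝ) < (2 : ENNReal).toReal := by norm_num
  simp only [memℓp_gen_iff h2]
  norm_num
  constructor
  · intro h j
    refine h.of_nonneg_of_le (fun n => by positivity) (fun n => ?_)
    have := PiLp.norm_apply_le (w n) j
    gcongr
  · intro h
    simp only [EuclideanSpace.norm_sq_eq]
    exact summable_sum fun j _ => h j

theorem memℓp_shift {f : ℤ → ℂ} (hf : Memℓp f 2) (m : ℤ) :
    Memℓp (fun n => f (n + m)) 2 := by
  have h2 : (0 : ℝ) < (2 : ENNReal).toReal := by norm_num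
  rw [memℓp_gen_iff h2] at hf ⊢
  exact (Equiv.addRight m).summable_iff.mpr hf

theorem memℓp_bdd_mul {f : ℤ → ℂ} (hf : Memℓp f 2) (a : ℤ → ℂ) (K : ℝ)
    (ha : ∀ n, ‖a n‖ ≤ K) : Memℓp (fun n => a n * f n) 2 := by
  have h2 : (0 : ℝ) < (2 : ENNReal).toReal := by norm_num
  rw [memℓp_gen_iff h2] at hf ⊢
  norm_num at hf ⊢
  refine (hf.mul_left (K ^ 2)).of_nonneg_of_le (fun n => by positivity) (fun n => ?_)
  rw [mul_pow]
  have := ha n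
  gcongr

theorem phase_norm (k : ℝ) : ‖phase k‖ = 1 := by
  rw [phase, mul_comm, Complex.norm_exp_ofReal_mul_I]

/-- A common bound for all hopping coefficients. -/
def hopBound (p : Params) : ℝ :=
  |p.bPlus| + |p.bMinus| + |p.bPlus + p.δPlus| + |p.bMinus + p.δMinus| + |p.c|

theorem hopB_norm (p : Params) (n : ℤ) : ‖-(hopB p n : ℂ)‖ ≤ hopBound p := by
  rw [norm_neg, Complex.norm_real, Real.norm_eq_abs, hopB, hopBound]
  split_ifs <;>
  linarith [abs_nonneg p.bPlus, abs_nonneg p.bMinus, abs_nonneg (p.bPlus + p.δPlus),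
    abs_nonneg (p.bMinus + p.δMinus), abs_nonneg p.c]

theorem hopC_norm (p : Params) (n : ℤ) : ‖-(hopC p n : ℂ)‖ ≤ hopBound p := by
  rw [norm_neg, Complex.norm_real, Real.norm_eq_abs, hopC, hopBound]
  split_ifs <;>
  linarith [abs_nonneg p.bPlus, abs_nonneg p.bMinus, abs_nonneg (p.bPlus + p.δPlus),
    abs_nonneg (p.bMinus + p.δMinus), abs_nonneg p.c]

theorem hopD_norm (p : Params) (n : ℤ) : ‖-(hopD p n : ℂ)‖ ≤ hopBound p := by
  rw [norm_neg, Complex.norm_real, Real.norm_eq_abs, hopD, hopBound]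
  split_ifs <;>
  linarith [abs_nonneg p.bPlus, abs_nonneg p.bMinus, abs_nonneg (p.bPlus + p.δPlus),
    abs_nonneg (p.bMinus + p.δMinus), abs_nonneg p.c]

theorem hamFun_memℓp (p : Params) (k : ℝ) {w : ℤ → EuclideanSpace ℂ (Fin 6)}
    (hw : Memℓp w 2) : Memℓp (hamFun p k w) 2 := by
  have hc := (memℓp_iff_coord w).1 hw
  have hB : ∀ j, Memℓp (fun n => -(hopB p n : ℂ) * w n j) 2 := fun j =>
    memℓp_bdd_mul (hc j) _ _ (hopB_norm p)
  have hC : ∀ (j : Fin 6) (m l : ℤ) (z : ℂ), ‖z‖ = 1 →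
      Memℓp (fun n => (-(hopC p (n + l) : ℂ) * z) * w (n + m) j) 2 := fun j m l z hz =>
    memℓp_bdd_mul (memℓp_shift (hc j) m) _ (hopBound p) fun n => by
      rw [norm_mul, hz, mul_one]; exact hopC_norm p _
  have hD : ∀ (j : Fin 6) (m l : ℤ) (z : ℂ), ‖z‖ = 1 →
      Memℓp (fun n => (-(hopD p (n + l) : ℂ) * z) * w (n + m) j) 2 := fun j m l z hz =>
    memℓp_bdd_mul (memℓp_shift (hc j) m) _ (hopBound p) fun n => by
      rw [norm_mul, hz, mul_one]; exact hopD_norm p _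
  have h1 : ‖(1 : ℂ)‖ = 1 := norm_one
  rw [memℓp_iff_coord]
  intro j
  fin_cases j
  · convert ((hB 3).add (hB 4)).add (hC 5 1 0 _ (phase_norm (-k))) using 1
    funext n; simp [hamFun]; ring
  · convert ((hB 3).add (hD 4 (-2) (-2) _ (phase_norm k))).add (hB 5) using 1
    funext n; simp [hamFun, sub_eq_add_neg]
  · convert ((hC 3 1 0 1 h1).add (hB 4)).add (hB 5) using 1
    funext n; simp [hamFun]; ring
  · convert ((hB 0).add (hB 1)).add (hC 2 (-1) (-1) 1 h1) using 1
    funext n; simp [hamFun, sub_eq_add_neg]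
  · convert ((hB 0).add (hD 1 2 0 _ (phase_norm (-k)))).add (hB 2) using 1
    funext n; simp [hamFun]; ring
  · convert ((hC 0 (-1) (-1) _ (phase_norm k)).add (hB 1)).add (hB 2) using 1
    funext n; simp [hamFun, sub_eq_add_neg]

/-- The Bloch Hamiltonian `Ĥ_II(k)` of the type-II interface, acting on `ℓ²(ℤ; ℂ⁶)`. -/
def ham (p : Params) (k : ℝ) : Module.End ℂ Space where
  toFun w := ⟨hamFun p k w, hamFun_memℓp p k (lp.memℓp w)⟩
  map_add' u w := by
    ext n j
    change hamFun p k (⇑u + ⇑w) n j = hamFun p k u n j + hamFun p k w n j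
    fin_cases j <;> simp [hamFun] <;> ring
  map_smul' a w := by
    ext n j
    change hamFun p k (a • ⇑w) n j = a * hamFun p k w n j
    fin_cases j <;> simp [hamFun] <;> ring

end TypeII

end

/-!
At `k = 0` the Hamiltonian maps each of the sublattices `{1, 2, 3}` and `{4, 5, 6}` into the other.
On a half-line, the combinations symmetric and antisymmetric under exchanging the outer components
of a sublattice decouple and satisfy constant-coefficient recurrences, whose characteristic roots
avoid the unit circle because `δ ≠ 0`. Hence `Ĥ(0)` together with the restriction to finitely many
cells is bounded below; being self-adjoint, `Ĥ(0)` has closed range, and the spectrum near zero of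
any small self-adjoint perturbation consists of eigenvalues.

If `δ₋ < 0 < δ₊`, then the kernel of `Ĥ(0)` is spanned by one mode on each sublattice, with
exponentially decaying positive profiles. The derivative `H₁` of `Ĥ(k)` at `0` is off-diagonal in
these modes, and its off-diagonal entry is, up to a phase, a sum of positive terms. So `H₁`
compressed to the kernel has the eigenvalues `±μ` with `μ > 0`. Solving `Ĥ(0) w₁ = -(H₁ - μ) w₀`
for the kernel vector `w₀` belonging to `μ` gives a quasimode `w₀ + k w₁` whose residual at energy
`μ k` is `O(k²)`, hence an eigenvalue `μ k + O(k²)`. Chirality changes the sign of the energy, and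
a reflection exchanges the two signs of `δ±`.
-/

noncomputable section

open scoped NNReal lp ComplexConjugate

section Perturbation

variable {𝕜 E F G : Type*} [NontriviallyNormedField 𝕜] [NormedAddCommGroup E] [NormedSpace 𝕜 E]
  [NormedAddCommGroup F] [NormedSpace 𝕜 F] [NormedAddCommGroup G] [NormedSpace 𝕜 G]

theorem exists_eventually_nhds_antilipschitzWith_prod {A : E →L[𝕜] G} {K : E →L[𝕜] F} {C : ℝ≥0}
    (hAK : AntilipschitzWith C (A.prod K)) :
    ∃ C', ∀ᶠ B in 𝓝 A, AntilipschitzWith C' (B.prod K) := by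
  have hAK' : AntilipschitzWith (C + 1) (A.prod K) := fun x y => (hAK x y).trans (by
    gcongr; exact le_self_add)
  refine ⟨((C + 1)⁻¹ - (C + 1)⁻¹ / 2)⁻¹, ?_⟩
  have hpos : 0 < (C + 1)⁻¹ / 2 := by positivity
  filter_upwards [Metric.ball_mem_nhds A (NNReal.coe_pos.2 hpos)] with B hB
  refine hAK'.add_sub_lipschitzWith (g := B.prod K) ?_ (half_lt_self (by positivity))
  refine LipschitzWith.of_dist_le_mul fun x y => ?_
  have hsub : (⇑(B.prod K) - ⇑(A.prod K)) x - (⇑(B.prod K) - ⇑(A.prod K)) y =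
      ((B - A) (x - y), 0) := by
    ext <;> simp [sub_sub_sub_comm]
  rw [dist_eq_norm, hsub, dist_eq_norm, Prod.norm_mk, norm_zero, max_eq_left (norm_nonneg _)]
  exact (B - A).le_of_opNorm_le (mem_ball_iff_norm.1 hB).le _

end Perturbation

section FiniteRank

variable {𝕜 E F G : Type*} [RCLike 𝕜]
  [NormedAddCommGroup E] [NormedSpace 𝕜 E] [CompleteSpace E]
  [NormedAddCommGroup F] [NormedSpace 𝕜 F] [FiniteDimensional 𝕜 F]
  [NormedAddCommGroup G] [NormedSpace 𝕜 G]

theorem exists_tendsto_subseq_of_antilipschitzWith_prod {A : E →L[𝕜] G} {K : E →L[𝕜] F} {C : ℝ≥0}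
    (hAK : AntilipschitzWith C (A.prod K)) {w : ℕ → E} {R : ℝ} (hw : ∀ n, ‖w n‖ ≤ R) {y : G}
    (hAw : Tendsto (fun n => A (w n)) atTop (𝓝 y)) :
    ∃ v, ∃ φ : ℕ → ℕ, StrictMono φ ∧ Tendsto (w ∘ φ) atTop (𝓝 v) := by
  have : ProperSpace F := FiniteDimensional.proper_rclike 𝕜 F
  have hKw (n : ℕ) : K (w n) ∈ Metric.closedBall (0 : F) (‖K‖ * R) :=
    mem_closedBall_zero_iff.2 (K.le_opNorm_of_le (hw n))
  obtain ⟨z, -, φ, hφ, hz⟩ := tendsto_subseq_of_bounded Metric.isBounded_closedBall hKw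
  have hembedding := hAK.isClosedEmbedding (A.prod K).uniformContinuous
  have hlim : Tendsto (A.prod K ∘ (w ∘ φ)) atTop (𝓝 (y, z)) :=
    (hAw.comp hφ.tendsto_atTop).prodMk_nhds hz
  obtain ⟨v, hv⟩ := hembedding.isClosed_range.mem_of_tendsto hlim
    (Eventually.of_forall fun n => ⟨w (φ n), rfl⟩)
  exact ⟨v, φ, hφ, hembedding.tendsto_nhds_iff.2 (hv ▸ hlim)⟩

theorem exists_antilipschitzWith_of_injective {A : E →L[𝕜] G} {K : E →L[𝕜] F} {C : ℝ≥0}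
    (hAK : AntilipschitzWith C (A.prod K)) (hA : Function.Injective A) :
    ∃ c, AntilipschitzWith c A := by
  by_contra! hcon
  have hunit (n : ℕ) : ∃ w : E, ‖w‖ = 1 ∧ ‖A w‖ ≤ 1 / ((n : ℝ) + 1) := by
    have hn : ¬ ∀ w, ‖w‖ ≤ ((n + 1 : ℝ≥0) : ℝ) * ‖A w‖ := fun h =>
      hcon _ (A.antilipschitz_of_bound h)
    push Not at hn
    obtain ⟨w, hw⟩ := hn
    have hw0 : w ≠ 0 := by rintro rfl; simp at hw
    refine ⟨((‖w‖⁻¹ : ℝ) : 𝕜) • w, ?_, ?_⟩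
    · rw [norm_smul, RCLike.norm_ofReal, abs_inv, abs_norm,
        inv_mul_cancel₀ (norm_ne_zero_iff.2 hw0)]
    · rw [map_smul, norm_smul, RCLike.norm_ofReal, abs_inv, abs_norm,
        inv_mul_le_iff₀ (norm_pos_iff.2 hw0), mul_one_div, le_div_iff₀' (by positivity)]
      exact_mod_cast hw.le
  choose w hw hAw using hunit
  have hAw0 : Tendsto (fun n => A (w n)) atTop (𝓝 0) :=
    squeeze_zero_norm hAw tendsto_one_div_add_atTop_nhds_zero_nat
  obtain ⟨v, φ, hφ, hv⟩ :=
    exists_tendsto_subseq_of_antilipschitzWith_prod hAK (fun n => (hw n).le) hAw0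
  have hAv : A v = 0 :=
    tendsto_nhds_unique ((A.continuous.tendsto v).comp hv) (hAw0.comp hφ.tendsto_atTop)
  have hv1 : ‖v‖ = 1 := tendsto_nhds_unique hv.norm (by simp [hw])
  rw [(map_eq_zero_iff A hA).1 hAv, norm_zero] at hv1
  exact zero_ne_one hv1

end FiniteRank

section SelfAdjoint

variable {𝕜 E F : Type*} [RCLike 𝕜]
  [NormedAddCommGroup E] [InnerProductSpace 𝕜 E] [CompleteSpace E]
  [NormedAddCommGroup F] [NormedSpace 𝕜 F] [FiniteDimensional 𝕜 F]

theorem isClosed_range_of_antilipschitzWith_prod {G : Type*} [NormedAddCommGroup G]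
    [NormedSpace 𝕜 G] {A : E →L[𝕜] G} {K : E →L[𝕜] F} {C : ℝ≥0}
    (hAK : AntilipschitzWith C (A.prod K)) : IsClosed (A.range : Set G) := by
  let N := A.ker
  have : CompleteSpace N := A.isClosed_ker.completeSpace_coe
  have hrestrict : AntilipschitzWith (1 * C) ((A ∘L Nᗮ.subtypeL).prod (K ∘L Nᗮ.subtypeL)) :=
    hAK.comp (AntilipschitzWith.subtype_coe (Nᗮ : Set E))
  have hinj : Function.Injective (A ∘L Nᗮ.subtypeL) := by
    refine (injective_iff_map_eq_zero _).2 fun x hx => ?_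
    exact Subtype.ext (N.inf_orthogonal_eq_bot.le ⟨hx, x.2⟩)
  obtain ⟨c, hc⟩ := exists_antilipschitzWith_of_injective hrestrict hinj
  convert hc.isClosed_range (A ∘L Nᗮ.subtypeL).uniformContinuous using 1
  ext y
  constructor
  · rintro ⟨x, rfl⟩
    obtain ⟨n, hn, m, hm, rfl⟩ := N.exists_add_mem_mem_orthogonal x
    refine ⟨⟨m, hm⟩, ?_⟩
    have hAn : A n = 0 := hn
    simp [hAn]
  · rintro ⟨x, rfl⟩
    exact ⟨x, rfl⟩

theorem orthogonal_ker_eq_range {A : E →L[𝕜] E} {K : E →L[𝕜] F} {C : ℝ≥0} (hA : IsSelfAdjoint A)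
    (hAK : AntilipschitzWith C (A.prod K)) : A.kerᗮ = A.range := by
  rw [A.orthogonal_ker, hA.adjoint_eq]
  exact (isClosed_range_of_antilipschitzWith_prod hAK).submodule_topologicalClosure_eq

theorem isUnit_of_injective {A : E →L[𝕜] E} {K : E →L[𝕜] F} {C : ℝ≥0} (hA : IsSelfAdjoint A)
    (hAK : AntilipschitzWith C (A.prod K)) (hinj : Function.Injective A) : IsUnit A := by
  refine ContinuousLinearMap.isUnit_iff_bijective.2 ⟨hinj, LinearMap.range_eq_top.1 ?_⟩
  exact (orthogonal_ker_eq_range hA hAK).symm.trans (by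
    rw [show A.ker = ⊥ from LinearMap.ker_eq_bot.2 hinj, Submodule.bot_orthogonal_eq_top])

end SelfAdjoint

section Spectrum

variable {𝓗 F : Type*} [NormedAddCommGroup 𝓗] [InnerProductSpace ℂ 𝓗] [CompleteSpace 𝓗]
  [NormedAddCommGroup F] [NormedSpace ℂ F] [FiniteDimensional ℂ F]

theorem exists_mem_spectrum_abs_le {A : 𝓗 →L[ℂ] 𝓗} (hA : IsSelfAdjoint A) {ε : ℝ} {w : 𝓗}
    (hw : w ≠ 0) (h : ‖A w‖ ≤ ε * ‖w‖) : ∃ e ∈ spectrum ℝ A, |e| ≤ ε := by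
  have hwpos : 0 < ‖w‖ := norm_pos_iff.2 hw
  have : Nontrivial 𝓗 := ⟨⟨w, 0, hw⟩⟩
  by_cases hu : IsUnit A
  · obtain ⟨u, rfl⟩ := hu
    have hcont : ContinuousOn (fun x : ℝ => x⁻¹) (spectrum ℝ (u : 𝓗 →L[ℂ] 𝓗)) :=
      continuousOn_inv₀.mono fun x hx => spectrum.ne_zero_of_mem_of_unit hx
    obtain ⟨e, he, henorm⟩ :=
      (IsGreatest.norm_cfc (fun x : ℝ => x⁻¹) (u : 𝓗 →L[ℂ] 𝓗) hcont hA).1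
    refine ⟨e, he, ?_⟩
    have he0 : e ≠ 0 := spectrum.ne_zero_of_mem_of_unit he
    rw [cfc_inv_id (R := ℝ) u hA] at henorm
    have hinv : (↑u⁻¹ : 𝓗 →L[ℂ] 𝓗) ((u : 𝓗 →L[ℂ] 𝓗) w) = w :=
      congrArg (fun B : 𝓗 →L[ℂ] 𝓗 => B w) u.inv_mul
    have hle : ‖w‖ ≤ |e|⁻¹ * (ε * ‖w‖) := by
      calc ‖w‖ = ‖(↑u⁻¹ : 𝓗 →L[ℂ] 𝓗) ((u : 𝓗 →L[ℂ] 𝓗) w)‖ := by rw [hinv]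
        _ ≤ ‖(↑u⁻¹ : 𝓗 →L[ℂ] 𝓗)‖ * (ε * ‖w‖) := ContinuousLinearMap.le_opNorm_of_le _ h
        _ = |e|⁻¹ * (ε * ‖w‖) := by rw [← henorm]; simp
    rw [← mul_assoc, inv_mul_eq_div] at hle
    exact (one_le_div (abs_pos.2 he0)).1 (one_le_of_le_mul_right₀ hwpos hle)
  · refine ⟨0, spectrum.zero_mem_iff ℝ |>.2 hu, ?_⟩
    rw [abs_zero]
    exact nonneg_of_mul_nonneg_left ((norm_nonneg _).trans h) hwpos

theorem exists_mem_spectrum_abs_sub_le {A : 𝓗 →L[ℂ] 𝓗} (hA : IsSelfAdjoint A) {l ε : ℝ} {w : 𝓗}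
    (hw : w ≠ 0) (h : ‖A w - (l : ℂ) • w‖ ≤ ε * ‖w‖) : ∃ e ∈ spectrum ℝ A, |e - l| ≤ ε := by
  have hsa : IsSelfAdjoint (A - algebraMap ℝ (𝓗 →L[ℂ] 𝓗) l) := hA.sub (.algebraMap _ (.all l))
  obtain ⟨e, he, hle⟩ := exists_mem_spectrum_abs_le hsa hw h
  refine ⟨e + l, ?_, by rwa [add_sub_cancel_right]⟩
  rwa [← spectrum.add_mem_add_iff (s := l), add_sub_cancel] at he

theorem hasEigenvalue_of_mem_spectrum {A : 𝓗 →L[ℂ] 𝓗} (hA : IsSelfAdjoint A) {e : ℝ}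
    (he : e ∈ spectrum ℝ A) {K : 𝓗 →L[ℂ] F} {C : ℝ≥0}
    (hAK : AntilipschitzWith C ((A - algebraMap ℝ (𝓗 →L[ℂ] 𝓗) e).prod K)) :
    Module.End.HasEigenvalue (A : 𝓗 →ₗ[ℂ] 𝓗) (e : ℂ) := by
  have hsa : IsSelfAdjoint (A - algebraMap ℝ (𝓗 →L[ℂ] 𝓗) e) := hA.sub (.algebraMap _ (.all e))
  have hinj : ¬ Function.Injective (A - algebraMap ℝ (𝓗 →L[ℂ] 𝓗) e) := fun hinj => by
    have hunit := (isUnit_of_injective hsa hAK hinj).neg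
    rw [neg_sub] at hunit
    exact he hunit
  rw [injective_iff_map_eq_zero] at hinj
  push Not at hinj
  obtain ⟨w, hw, hw0⟩ := hinj
  exact Module.End.hasEigenvalue_of_hasEigenvector
    ⟨Module.End.mem_eigenspace_iff.2 (sub_eq_zero.1 hw), hw0⟩

theorem exists_eigenvalue_isBigO {ι : Type*} {l : Filter ι} {A : ι → 𝓗 →L[ℂ] 𝓗} {A₀ : 𝓗 →L[ℂ] 𝓗}
    {K : 𝓗 →L[ℂ] F} {C : ℝ≥0} (hsa : ∀ i, IsSelfAdjoint (A i)) (hA : Tendsto A l (𝓝 A₀))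
    (hAK : AntilipschitzWith C (A₀.prod K)) {a g : ι → ℝ} (ha : Tendsto a l (𝓝 0))
    (hg : Tendsto g l (𝓝 0)) {q : ι → 𝓗} {w : 𝓗} (hq : Tendsto q l (𝓝 w)) (hw : w ≠ 0)
    (hres : (fun i => A i (q i) - (a i : ℂ) • q i) =O[l] g) :
    ∃ e : ι → ℝ, (∀ᶠ i in l, Module.End.HasEigenvalue (A i : 𝓗 →ₗ[ℂ] 𝓗) (e i : ℂ)) ∧
      (fun i => e i - a i) =O[l] g := by
  obtain ⟨D, hD, hbound⟩ := hres.exists_pos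
  have hqlow : ∀ᶠ i in l, ‖w‖ / 2 < ‖q i‖ :=
    hq.norm.eventually_const_lt (half_lt_self (norm_pos_iff.2 hw))
  have hspec : ∀ᶠ i in l, ∃ e : ℝ, e ∈ spectrum ℝ (A i) ∧ |e - a i| ≤ 2 * D / ‖w‖ * ‖g i‖ := by
    filter_upwards [hbound.bound, hqlow] with i hi hqi
    have hqi0 : q i ≠ 0 := norm_pos_iff.1 ((by positivity : (0 : ℝ) ≤ ‖w‖ / 2).trans_lt hqi)
    refine exists_mem_spectrum_abs_sub_le (hsa i) hqi0 (hi.trans ?_)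
    have : 0 < ‖w‖ := norm_pos_iff.2 hw
    calc D * ‖g i‖ = 2 * D / ‖w‖ * ‖g i‖ * (‖w‖ / 2) := by field_simp
      _ ≤ 2 * D / ‖w‖ * ‖g i‖ * ‖q i‖ := by gcongr
  obtain ⟨e, he⟩ := skolem.1 hspec
  have hea : (fun i => e i - a i) =O[l] g := .of_bound _ (he.mono fun i hi => hi.2)
  refine ⟨e, ?_, hea⟩
  have he0 : Tendsto e l (𝓝 0) := by
    simpa using (hea.trans_tendsto hg).add ha
  have hshift : Tendsto (fun i => A i - algebraMap ℝ (𝓗 →L[ℂ] 𝓗) (e i)) l (𝓝 A₀) := by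
    simpa using hA.sub (((algebraMapCLM ℝ (𝓗 →L[ℂ] 𝓗)).continuous.tendsto 0).comp he0)
  obtain ⟨C', hC'⟩ := exists_eventually_nhds_antilipschitzWith_prod hAK
  filter_upwards [he, hshift.eventually hC'] with i hi hCi
  exact hasEigenvalue_of_mem_spectrum (hsa i) hi.1 hCi

theorem exists_eigenvalue_branch {H : ℝ → 𝓗 →L[ℂ] 𝓗} {H₁ : 𝓗 →L[ℂ] 𝓗}
    (hsa : ∀ k, IsSelfAdjoint (H k))
    (hH : (fun k => H k - H 0 - (k : ℂ) • H₁) =O[𝓝 0] fun k => k ^ 2)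
    {K : 𝓗 →L[ℂ] F} {C : ℝ≥0} (hK : AntilipschitzWith C ((H 0).prod K)) {μ : ℝ} {w₀ : 𝓗}
    (hw₀ : w₀ ≠ 0) (hker : H 0 w₀ = 0) (hperp : H₁ w₀ - (μ : ℂ) • w₀ ∈ (H 0).kerᗮ) :
    ∃ e : ℝ → ℝ, (∀ᶠ k in 𝓝 0, Module.End.HasEigenvalue (H k : 𝓗 →ₗ[ℂ] 𝓗) (e k : ℂ)) ∧
      (fun k => e k - μ * k) =O[𝓝 0] fun k => k ^ 2 := by
  rw [orthogonal_ker_eq_range (hsa 0) hK] at hperp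
  obtain ⟨w₁, hw₁⟩ : ∃ w₁, H 0 w₁ = -(H₁ w₀ - (μ : ℂ) • w₀) := (H 0).range.neg_mem hperp
  have hsq : Tendsto (fun k : ℝ => k ^ 2) (𝓝 0) (𝓝 0) := by
    simpa using (continuous_pow 2).tendsto (0 : ℝ)
  have hlin {V : Type _} [NormedAddCommGroup V] [NormedSpace ℂ V] (v : V) :
      Tendsto (fun k : ℝ => (k : ℂ) • v) (𝓝 0) (𝓝 0) := by
    have hcont : Continuous fun k : ℝ => (k : ℂ) • v := by fun_prop
    simpa using hcont.tendsto 0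
  have hH0 : Tendsto H (𝓝 0) (𝓝 (H 0)) := by
    simpa using ((hH.trans_tendsto hsq).add (hlin H₁)).add_const (H 0)
  have hq : Tendsto (fun k : ℝ => w₀ + (k : ℂ) • w₁) (𝓝 0) (𝓝 w₀) := by
    simpa using (hlin w₁).const_add w₀
  have hμ : Tendsto (fun k : ℝ => μ * k) (𝓝 0) (𝓝 0) := by
    simpa using (continuous_const_mul μ).tendsto 0
  refine exists_eigenvalue_isBigO hsa hH0 hK hμ hsq hq hw₀ ?_
  have hres (k : ℝ) : H k (w₀ + (k : ℂ) • w₁) - ((μ * k : ℝ) : ℂ) • (w₀ + (k : ℂ) • w₁) =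
      (H k - H 0 - (k : ℂ) • H₁) (w₀ + (k : ℂ) • w₁)
        + ((k ^ 2 : ℝ) : ℂ) • (H₁ w₁ - (μ : ℂ) • w₁) := by
    simp only [sub_apply, smul_apply, map_add, map_smul, hker, hw₁, Complex.ofReal_mul,
      Complex.ofReal_pow]
    module
  simp only [hres]
  refine .add ?_ ?_
  · have hle : ∀ k : ℝ, ‖(H k - H 0 - (k : ℂ) • H₁) (w₀ + (k : ℂ) • w₁)‖ ≤
        ‖H k - H 0 - (k : ℂ) • H₁‖ * ‖w₀ + (k : ℂ) • w₁‖ := fun k =>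
      ContinuousLinearMap.le_opNorm _ _
    simpa using (IsBigO.of_norm_le hle).trans (hH.norm_left.mul (hq.norm.isBigO_one ℝ))
  · exact .of_bound _ (.of_forall fun k => by rw [norm_smul, Complex.norm_real, mul_comm])

end Spectrum

section TwoLevel

variable {E : Type*} [NormedAddCommGroup E] [InnerProductSpace ℂ E]

-- The compression of `T` to the span is off-diagonal, so its eigenvalues are `± |⟪u, T v⟫|`
-- after normalizing `u` and `v`.
theorem exists_mem_span_pair_sub_smul_mem_orthogonal {T : E →ₗ[ℂ] E} (hT : T.IsSymmetric) {u v : E}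
    (huv : inner ℂ u v = 0) (hu : inner ℂ u (T u) = 0) (hv : inner ℂ v (T v) = 0)
    (huTv : inner ℂ u (T v) ≠ 0) :
    ∃ w ∈ Submodule.span ℂ {u, v}, w ≠ 0 ∧
      T w - ((‖inner ℂ u (T v)‖ / (‖u‖ * ‖v‖) : ℝ) : ℂ) • w ∈ (Submodule.span ℂ {u, v})ᗮ := by
  have hu0 : (‖u‖ : ℂ) ≠ 0 := by
    rw [Complex.ofReal_ne_zero, norm_ne_zero_iff]; rintro rfl; simp at huTv
  have hv0 : (‖v‖ : ℂ) ≠ 0 := by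
    rw [Complex.ofReal_ne_zero, norm_ne_zero_iff]; rintro rfl; simp at huTv
  have hvu : inner ℂ v u = 0 := inner_eq_zero_symm.1 huv
  have hvTu : inner ℂ v (T u) = starRingEnd ℂ (inner ℂ u (T v)) := by
    rw [inner_conj_symm, hT]
  set ζ := inner ℂ u (T v)
  let w := (ζ * ‖v‖) • u + (‖ζ‖ * ‖u‖ : ℂ) • v
  have huw : inner ℂ u w = ζ * ‖v‖ * ‖u‖ ^ 2 := by
    simp [w, huv, inner_self_eq_norm_sq_to_K]
  have hvw : inner ℂ v w = ‖ζ‖ * ‖u‖ * ‖v‖ ^ 2 := by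
    simp [w, hvu, inner_self_eq_norm_sq_to_K]
  have huTw : inner ℂ u (T w) = ‖ζ‖ * ‖u‖ * ζ := by
    simp [w, hu, ζ]
  have hvTw : inner ℂ v (T w) = ‖ζ‖ ^ 2 * ‖v‖ := by
    simp [w, hv, hvTu, ζ, ← Complex.conj_mul']
    ring
  refine ⟨w, Submodule.mem_span_pair.2 ⟨_, _, rfl⟩, fun hw => ?_, ?_⟩
  · rw [hw, inner_zero_right, eq_comm] at huw
    simp_all
  · have hu' : inner ℂ u (T w - ((‖ζ‖ / (‖u‖ * ‖v‖) : ℝ) : ℂ) • w) = 0 := by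
      rw [inner_sub_right, inner_smul_right, huTw, huw]
      push_cast
      field_simp
      ring
    have hv' : inner ℂ v (T w - ((‖ζ‖ / (‖u‖ * ‖v‖) : ℝ) : ℂ) • w) = 0 := by
      rw [inner_sub_right, inner_smul_right, hvTw, hvw]
      push_cast
      field_simp
      ring
    rw [Submodule.mem_orthogonal]
    intro x hx
    obtain ⟨α, β, rfl⟩ := Submodule.mem_span_pair.1 hx
    rw [inner_add_left, inner_smul_left, inner_smul_left, hu', hv', mul_zero, mul_zero, add_zero]

end TwoLevel

theorem hasEigenvalue_mul_of_forall_apply_eq_smul {K V V' : Type*} [Field K] [AddCommGroup V]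
    [Module K V] [AddCommGroup V'] [Module K V'] {f : Module.End K V} {g : Module.End K V'}
    {T : V →ₗ[K] V'} {s e : K} (hT : Function.Injective T) (h : ∀ v, g (T v) = s • T (f v))
    (he : f.HasEigenvalue e) : g.HasEigenvalue (s * e) := by
  obtain ⟨v, hv⟩ := he.exists_hasEigenvector
  refine Module.End.hasEigenvalue_of_hasEigenvector (x := T v)
    ⟨Module.End.mem_eigenspace_iff.2 ?_, (map_ne_zero_iff T hT).2 hv.2⟩
  rw [h, hv.apply_eq_smul, map_smul, smul_smul]

section SquareSummable

variable {ι : Type*} {E : ι → Type*} [∀ i, NormedAddCommGroup (E i)]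

theorem memℓp_two_iff_summable {f : ∀ i, E i} : Memℓp f 2 ↔ Summable fun i => ‖f i‖ ^ 2 := by
  simpa using memℓp_gen_iff (f := f) (p := 2) (by norm_num)

theorem hasSum_norm_sq (x : lp E 2) : HasSum (fun i => ‖x i‖ ^ 2) (‖x‖ ^ 2) := by
  simpa using lp.hasSum_norm (p := 2) (by norm_num) x

theorem memℓp_two_of_summable_norm {ι E : Type*} [NormedAddCommGroup E] {f : ι → E}
    (hf : Summable fun i => ‖f i‖) : Memℓp f 2 :=
  have hf₁ : Memℓp f 1 := memℓp_gen (by simpa using hf)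
  hf₁.of_exponent_ge one_le_two

theorem memℓp_two_comp {κ V : Type*} [NormedAddCommGroup V] {f : ι → V} (hf : Memℓp f 2)
    {g : κ → ι} (hg : Function.Injective g) : Memℓp (fun i => f (g i)) 2 := by
  rw [memℓp_two_iff_summable] at hf ⊢
  exact hf.comp_injective hg

end SquareSummable

section IsBigO

variable {𝕜 W E : Type*} [NormedField 𝕜] [NormedAddCommGroup E] [NormedSpace 𝕜 E] {l : Filter W}
  {f g : W → E} {Q : W → ℝ}

theorem isBigO_fun_const_smul_left (h : f =O[l] Q) (a : 𝕜) : (fun w => a • f w) =O[l] Q :=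
  (IsBigO.const_smul_self a).trans h

variable (𝕜) in
theorem isBigO_and_isBigO_of_add_of_sub [CharZero 𝕜] (hadd : (fun w => f w + g w) =O[l] Q)
    (hsub : (fun w => f w - g w) =O[l] Q) : f =O[l] Q ∧ g =O[l] Q := by
  constructor
  · refine (isBigO_fun_const_smul_left (hadd.add hsub) (2⁻¹ : 𝕜)).congr_left fun w => ?_
    match_scalars <;> ring
  · refine (isBigO_fun_const_smul_left (hadd.sub hsub) (2⁻¹ : 𝕜)).congr_left fun w => ?_
    match_scalars <;> ring

end IsBigO

section LeftShift

variable {𝕜 V : Type*} [NormedField 𝕜] [NormedAddCommGroup V] [NormedSpace 𝕜 V]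

variable (𝕜) in
/-- The left shift `(x₀, x₁, …) ↦ (x₁, x₂, …)` on `ℓ²(ℕ)`; difference equations on a half-line are
polynomial equations in it. -/
def leftShift : ℓ²(ℕ, V) →ₗ[𝕜] ℓ²(ℕ, V) where
  toFun x := ⟨fun n => x (n + 1), memℓp_two_comp (lp.memℓp x) (add_left_injective 1)⟩
  map_add' _ _ := rfl
  map_smul' _ _ := rfl

@[simp]
theorem leftShift_apply (x : ℓ²(ℕ, V)) (n : ℕ) : leftShift 𝕜 x n = x (n + 1) := rfl

theorem norm_sq_eq_add_norm_leftShift_sq (x : ℓ²(ℕ, V)) :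
    ‖x‖ ^ 2 = ‖x 0‖ ^ 2 + ‖leftShift 𝕜 x‖ ^ 2 :=
  (hasSum_norm_sq x).unique (hasSum_norm_sq (leftShift 𝕜 x)).zero_add

theorem norm_leftShift_le (x : ℓ²(ℕ, V)) : ‖leftShift 𝕜 x‖ ≤ ‖x‖ :=
  le_of_sq_le_sq (by rw [norm_sq_eq_add_norm_leftShift_sq (𝕜 := 𝕜) x]; nlinarith [sq_nonneg ‖x 0‖])
    (norm_nonneg _)

theorem norm_le_norm_zero_add_norm_leftShift (x : ℓ²(ℕ, V)) : ‖x‖ ≤ ‖x 0‖ + ‖leftShift 𝕜 x‖ :=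
  le_of_sq_le_sq (by
    rw [norm_sq_eq_add_norm_leftShift_sq (𝕜 := 𝕜) x]
    nlinarith [norm_nonneg (x 0), norm_nonneg (leftShift 𝕜 x)]) (by positivity)

theorem one_sub_norm_mul_norm_le (σ : 𝕜) (x : ℓ²(ℕ, V)) :
    (1 - ‖σ‖) * ‖x‖ ≤ ‖x 0‖ + ‖leftShift 𝕜 x - σ • x‖ := by
  have h1 := norm_le_norm_zero_add_norm_leftShift (𝕜 := 𝕜) x
  have h2 := norm_le_norm_sub_add (leftShift 𝕜 x) (σ • x)
  rw [norm_smul] at h2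
  linarith

theorem norm_sub_one_mul_norm_le (σ : 𝕜) (x : ℓ²(ℕ, V)) :
    (‖σ‖ - 1) * ‖x‖ ≤ ‖leftShift 𝕜 x - σ • x‖ := by
  have h1 := norm_leftShift_le (𝕜 := 𝕜) x
  have h2 := norm_le_norm_add_norm_sub' (σ • x) (leftShift 𝕜 x)
  rw [norm_smul, norm_sub_rev] at h2
  linarith

theorem eq_zero_of_leftShift_eq_smul {σ : 𝕜} (hσ : 1 < ‖σ‖) {x : ℓ²(ℕ, V)}
    (hx : leftShift 𝕜 x = σ • x) : x = 0 := by
  have h := norm_sub_one_mul_norm_le σ x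
  rw [hx, sub_self, norm_zero] at h
  exact norm_le_zero_iff.1 (nonpos_of_mul_nonpos_right h (sub_pos.2 hσ))

variable {W : Type*} {l : Filter W} {g : W → ℓ²(ℕ, V)} {Q : W → ℝ}

theorem isBigO_leftShift (hg : g =O[l] Q) : (fun w => leftShift 𝕜 (g w)) =O[l] Q :=
  (IsBigO.of_bound' (.of_forall fun w => norm_leftShift_le (g w))).trans hg

theorem isBigO_of_leftShift_sub_smul {σ : 𝕜} (hσ : ‖σ‖ ≠ 1)
    (hg : (fun w => leftShift 𝕜 (g w) - σ • g w) =O[l] Q) (h0 : (fun w => g w 0) =O[l] Q) :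
    g =O[l] Q := by
  refine IsBigO.trans (.of_bound |1 - ‖σ‖|⁻¹ (.of_forall fun w => ?_))
    (h0.norm_left.add hg.norm_left)
  rw [← mul_comm (‖_‖), ← div_eq_mul_inv,
    le_div_iff₀ (abs_pos.2 (sub_ne_zero.2 hσ.symm)), mul_comm, Real.norm_of_nonneg (by positivity)]
  rcases abs_choice (1 - ‖σ‖) with h | h <;> rw [h]
  · exact one_sub_norm_mul_norm_le σ (g w)
  · rw [neg_sub]
    exact (norm_sub_one_mul_norm_le σ (g w)).trans (le_add_of_nonneg_left (norm_nonneg _))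

theorem leftShift_factor (ρ σ : 𝕜) (x : ℓ²(ℕ, V)) :
    leftShift 𝕜 (leftShift 𝕜 x - σ • x) - ρ • (leftShift 𝕜 x - σ • x) =
      leftShift 𝕜 (leftShift 𝕜 x) - (ρ + σ) • leftShift 𝕜 x + (ρ * σ) • x := by
  rw [map_sub, map_smul]
  module

theorem isBigO_of_leftShift_quadratic {ρ σ : 𝕜} (hρ : ‖ρ‖ ≠ 1) (hσ : ‖σ‖ ≠ 1)
    (hg : (fun w => leftShift 𝕜 (leftShift 𝕜 (g w)) - (ρ + σ) • leftShift 𝕜 (g w)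
      + (ρ * σ) • g w) =O[l] Q)
    (h0 : (fun w => g w 0) =O[l] Q) (h1 : (fun w => g w 1) =O[l] Q) : g =O[l] Q := by
  refine isBigO_of_leftShift_sub_smul hσ (isBigO_of_leftShift_sub_smul hρ ?_ ?_) h0
  · simpa only [leftShift_factor] using hg
  · exact h1.sub (h0.const_smul_left σ)

theorem isBigO_and_isBigO_of_leftShift [CharZero 𝕜] {f g : W → ℓ²(ℕ, V)} {ρ σ τ : 𝕜}
    (hρ : ‖ρ‖ ≠ 1) (hσ : ‖σ‖ ≠ 1) (hτ : ‖τ‖ ≠ 1)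
    (hadd : (fun w => leftShift 𝕜 (leftShift 𝕜 (f w + g w)) - (ρ + σ) • leftShift 𝕜 (f w + g w)
      + (ρ * σ) • (f w + g w)) =O[l] Q)
    (hsub : (fun w => leftShift 𝕜 (f w - g w) - τ • (f w - g w)) =O[l] Q)
    (hf0 : (fun w => f w 0) =O[l] Q) (hg0 : (fun w => g w 0) =O[l] Q)
    (hf1 : (fun w => f w 1) =O[l] Q) (hg1 : (fun w => g w 1) =O[l] Q) :
    f =O[l] Q ∧ g =O[l] Q :=
  isBigO_and_isBigO_of_add_of_sub 𝕜
    (isBigO_of_leftShift_quadratic hρ hσ hadd (hf0.add hg0) (hf1.add hg1))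
    (isBigO_of_leftShift_sub_smul hτ hsub (hf0.sub hg0))

end LeftShift

section Asymptotics

theorem isBigO_cos_sub_one : (fun k : ℝ => Real.cos k - 1) =O[𝓝 0] fun k => k ^ 2 := by
  refine .of_bound' (.of_forall fun k => ?_)
  rw [Real.norm_eq_abs, abs_le, Real.norm_of_nonneg (sq_nonneg k)]
  constructor <;> nlinarith [Real.one_sub_sq_div_two_le_cos (x := k), Real.cos_le_one k]

theorem isBigO_sin_sub_self : (fun k : ℝ => Real.sin k - k) =O[𝓝 0] fun k => k ^ 2 := by
  have hcube : (fun k : ℝ => Real.sin k - (k - k ^ 3 / 6)) =O[𝓝 0] fun k => k ^ 5 := by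
    refine .of_bound (1 / 100) ?_
    filter_upwards [Metric.closedBall_mem_nhds (0 : ℝ) one_pos] with k hk
    rw [Real.norm_eq_abs, norm_pow, Real.norm_eq_abs, one_div_mul_eq_div]
    exact Real.sin_bound (by simpa using hk)
  have h3 : (fun k : ℝ => k ^ 3) =O[𝓝 0] fun k => k ^ 2 :=
    (isLittleO_pow_pow (by norm_num)).isBigO
  have h5 : (fun k : ℝ => k ^ 5) =O[𝓝 0] fun k => k ^ 2 :=
    (isLittleO_pow_pow (by norm_num)).isBigO
  exact ((hcube.trans h5).sub (h3.const_mul_left (1 / 6))).congr_left fun k => by ring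

theorem eventually_ne_zero_of_sub_mul_isBigO {e : ℝ → ℝ} {μ : ℝ} (hμ : μ ≠ 0)
    (h : (fun k => e k - μ * k) =O[𝓝 0] fun k => k ^ 2) : ∀ᶠ k in 𝓝[≠] 0, e k ≠ 0 := by
  have hequiv : e ~[𝓝[≠] 0] fun k => μ * k := by
    refine (h.mono nhdsWithin_le_nhds).trans_isLittleO (.const_mul_right hμ ?_)
    simpa using (isLittleO_pow_pow one_lt_two).mono nhdsWithin_le_nhds
  filter_upwards [hequiv.isBigO_symm.eq_zero_imp, self_mem_nhdsWithin] with k hk hk0 hek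
  exact mul_ne_zero hμ hk0 (hk hek)

end Asymptotics

theorem hasSum_sub_shift_zero {G : Type*} [AddCommGroup G] [TopologicalSpace G]
    [IsTopologicalAddGroup G] {f : ℤ → G} (hf : Summable f) (m : ℤ) :
    HasSum (fun n => f (n - m) - f n) 0 := by
  simpa using ((Equiv.subRight m).hasSum_iff.2 hf.hasSum).sub hf.hasSum

section Extension

theorem int_induction_two_step_left {P : ℤ → Prop} (hnat : ∀ m : ℕ, P m)
    (step : ∀ n < 0, P (n + 1) → P (n + 2) → P n) (n : ℤ) : P n := by
  have hneg : ∀ m : ℕ, P (-m) ∧ P (-m + 1) := fun m => by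
    induction m with
    | zero => simpa using And.intro (hnat 0) (hnat 1)
    | succ m ih =>
      have h1 : -((m + 1 : ℕ) : ℤ) + 1 = -m := by push_cast; ring
      have h2 : -((m + 1 : ℕ) : ℤ) + 2 = -m + 1 := by push_cast; ring
      exact ⟨step _ (by simp; omega) (h1 ▸ ih.1) (h2 ▸ ih.2), h1 ▸ ih.1⟩
  rcases n.eq_nat_or_neg with ⟨m, rfl | rfl⟩
  exacts [hnat m, (hneg m).1]

theorem summable_of_two_step_le {t : ℕ → ℝ} (ht : ∀ m, 0 ≤ t m) {a b : ℝ} (ha : 0 ≤ a) (hb : 0 ≤ b)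
    (hab : a + b < 1) (hrec : ∀ m, t (m + 2) ≤ a * t (m + 1) + b * t m) : Summable t := by
  refine (summable_nat_add_iff 2).1 (summable_of_sum_range_le (c := (t 0 + t 1) / (1 - a - b))
    (fun m => ht _) fun N => ?_)
  set T := ∑ m ∈ Finset.range N, t (m + 2)
  have h1 : ∑ m ∈ Finset.range N, t (m + 1) ≤ T + t 1 := by
    rw [← Finset.sum_range_succ' fun m => t (m + 1)]
    exact Finset.sum_le_sum_of_subset_of_nonneg (Finset.range_mono N.le_succ) fun m _ _ => ht _
  have h0 : ∑ m ∈ Finset.range N, t m ≤ T + t 1 + t 0 := by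
    rw [← Finset.sum_range_succ' fun m => t (m + 1), ← Finset.sum_range_succ' t]
    exact Finset.sum_le_sum_of_subset_of_nonneg (Finset.range_mono (by omega)) fun m _ _ => ht _
  have hT : T ≤ a * (T + t 1) + b * (T + t 1 + t 0) := by
    calc
      T ≤ ∑ m ∈ Finset.range N, (a * t (m + 1) + b * t m) := Finset.sum_le_sum fun m _ => hrec m
      _ ≤ _ := by
        rw [Finset.sum_add_distrib, ← Finset.mul_sum, ← Finset.mul_sum]
        gcongr
  rw [le_div_iff₀ (by linarith)]
  nlinarith [ht 0, ht 1]

theorem exists_extension_left {K : Type*} [Semiring K] (f : ℕ → K) (α β : ℤ → K) :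
    ∃ x : ℤ → K, (∀ m : ℕ, x m = f m) ∧ ∀ n < 0, x n = α n * x (n + 1) + β n * x (n + 2) := by
  let g : ℕ → K × K := fun m => m.rec (f 0, f 1) fun m y =>
    (α (-(m + 1)) * y.1 + β (-(m + 1)) * y.2, y.1)
  let x : ℤ → K := fun n => if 0 ≤ n then f n.toNat else (g (-n).toNat).1
  have hx : ∀ m : ℕ, x (-m) = (g m).1 := by
    rintro (_ | m)
    · rfl
    · exact if_neg (by simp; omega)
  have hx' : ∀ m : ℕ, x (-m + 1) = (g m).2 := by
    rintro (_ | m)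
    · rfl
    · change x (-((m + 1 : ℕ) : ℤ) + 1) = (g m).1
      rw [← hx m]
      congr 1
      push_cast
      ring
  refine ⟨x, fun m => if_pos m.cast_nonneg, fun n hn => ?_⟩
  obtain ⟨m, rfl⟩ : ∃ m : ℕ, n = -(m + 1) := ⟨(-n - 1).toNat, by omega⟩
  have h1 : -((m : ℤ) + 1) + 1 = -m := by ring
  have h2 : -((m : ℤ) + 1) + 2 = -m + 1 := by ring
  rw [h1, h2, hx, hx']
  exact_mod_cast hx (m + 1)

theorem exists_pos_summable_extension_left {f : ℕ → ℝ} (hf : ∀ m, 0 < f m) (hfs : Summable f)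
    {α β : ℤ → ℝ} (hα : ∀ n, 0 < α n) (hβ : ∀ n, 0 ≤ β n) {a b : ℝ} (hab : a + b < 1)
    (hαa : ∀ᶠ n in atBot, α n ≤ a) (hβb : ∀ᶠ n in atBot, β n ≤ b) :
    ∃ x : ℤ → ℝ, (∀ n, 0 < x n) ∧ Summable x ∧ (∀ m : ℕ, x m = f m) ∧
      ∀ n < 0, x n = α n * x (n + 1) + β n * x (n + 2) := by
  obtain ⟨x, hxf, hrec⟩ := exists_extension_left f α β
  have hpos : ∀ n, 0 < x n := int_induction_two_step_left (fun m => by rw [hxf]; exact hf m)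
    fun n hn h1 h2 => by
      rw [hrec n hn]
      exact add_pos_of_pos_of_nonneg (mul_pos (hα n) h1) (mul_nonneg (hβ n) h2.le)
  obtain ⟨N, hN⟩ := eventually_atBot.1 (hαa.and hβb)
  have ha : 0 ≤ a := (hα N).le.trans (hN N le_rfl).1
  have hb : 0 ≤ b := (hβ N).trans (hN N le_rfl).2
  have hleft : Summable fun m : ℕ => x (-(m + 1)) := by
    refine (summable_nat_add_iff N.natAbs).1
      (summable_of_two_step_le (fun m => (hpos _).le) ha hb hab fun m => ?_)
    obtain ⟨n, hn⟩ : ∃ n : ℤ, n = -((m + 2 + N.natAbs : ℕ) + 1) := ⟨_, rfl⟩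
    have h1 : -(((m + 1 + N.natAbs : ℕ) : ℤ) + 1) = n + 1 := by omega
    have h2 : -(((m + N.natAbs : ℕ) : ℤ) + 1) = n + 2 := by omega
    obtain ⟨hαn, hβn⟩ := hN n (by omega)
    rw [h1, h2, ← hn, hrec n (by omega)]
    gcongr
    exacts [(hpos _).le, (hpos _).le]
  exact ⟨x, hpos, .of_nat_of_neg_add_one (by simpa only [hxf]) hleft, hxf, hrec⟩

end Extension

namespace TypeII

local notation "S" => leftShift ℂ

section BulkRoots

/-- `ρ` and `σ` are the roots of `a b X² + a² X - 2 b²`, encoded by Vieta's formulas. This is the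
characteristic polynomial of the zero-energy equation for a mode in the bulk supported on the first
sublattice and symmetric under exchanging its components `1` and `3`; `a` and `b` are the
intercell and intracell hopping coefficients. -/
structure IsBulkRoots (a b ρ σ : ℝ) : Prop where
  pos : 0 < ρ
  lt_neg_one : σ < -1
  add_eq : b * (ρ + σ) = -a
  mul_eq : a * (ρ * σ) = -2 * b

variable {a b ρ σ : ℝ}

theorem exists_isBulkRoots (ha : 0 < a) (hb : 0 < b) : ∃ ρ σ, IsBulkRoots a b ρ σ := by
  set s := √(a ^ 4 + 8 * a * b ^ 3)
  have hs : s ^ 2 = a ^ 4 + 8 * a * b ^ 3 := Real.sq_sqrt (by positivity)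
  have hs_pos : a ^ 2 < s := Real.lt_sqrt_of_sq_lt (by nlinarith [mul_pos ha (pow_pos hb 3)])
  have hs_neg : 2 * a * b - a ^ 2 < s := Real.lt_sqrt_of_sq_lt (by
    nlinarith [mul_pos (mul_pos ha hb) (by nlinarith : 0 < 2 * b ^ 2 - a * b + a ^ 2)])
  refine ⟨(s - a ^ 2) / (2 * a * b), (-s - a ^ 2) / (2 * a * b), ?_, ?_, ?_, ?_⟩
  · exact div_pos (sub_pos.2 hs_pos) (by positivity)
  · rw [div_lt_iff₀ (by positivity)]
    linarith
  · field_simp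
    ring
  · field_simp
    linear_combination -hs

theorem IsBulkRoots.one_sub_mul_one_sub (h : IsBulkRoots a b ρ σ) :
    a * b * ((1 - ρ) * (1 - σ)) = (a - b) * (a + 2 * b) := by
  linear_combination -a * h.add_eq + b * h.mul_eq

theorem IsBulkRoots.lt_one (h : IsBulkRoots a b ρ σ) (hb : 0 < b) (hab : b < a) : ρ < 1 := by
  have hprod : 0 < a * b * ((1 - ρ) * (1 - σ)) := by
    rw [h.one_sub_mul_one_sub]
    exact mul_pos (sub_pos.2 hab) (by linarith)
  have hσ := h.lt_neg_one
  have hρ := pos_of_mul_pos_left (pos_of_mul_pos_right hprod (by nlinarith)) (by linarith)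
  linarith

theorem IsBulkRoots.one_lt (h : IsBulkRoots a b ρ σ) (ha : 0 < a) (hab : a < b) : 1 < ρ := by
  have hprod : a * b * ((1 - ρ) * (1 - σ)) < 0 := by
    rw [h.one_sub_mul_one_sub]
    exact mul_neg_of_neg_of_pos (sub_neg.2 hab) (by linarith)
  have hσ := h.lt_neg_one
  have hρ := neg_of_mul_neg_left (neg_of_mul_neg_right hprod (by nlinarith)) (by linarith)
  linarith

theorem IsBulkRoots.norm_left_ne_one (h : IsBulkRoots a b ρ σ) (ha : 0 < a) (hb : 0 < b)
    (hab : a ≠ b) : ‖(ρ : ℂ)‖ ≠ 1 := by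
  rw [Complex.norm_real, Real.norm_of_nonneg h.pos.le]
  rcases hab.lt_or_gt with hlt | hgt
  exacts [(h.one_lt ha hlt).ne', (h.lt_one hb hgt).ne]

theorem IsBulkRoots.one_lt_norm_right (h : IsBulkRoots a b ρ σ) : 1 < ‖(σ : ℂ)‖ := by
  rw [Complex.norm_real, Real.norm_eq_abs]
  exact lt_abs.2 (.inr (by linarith [h.lt_neg_one]))

end BulkRoots

section Operator

theorem memℓp_coord (w : Space) (j : Fin 6) : Memℓp (fun n => w n j) 2 :=
  (memℓp_iff_coord w).1 (lp.memℓp w) j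

theorem ham_apply (p : Params) (k : ℝ) (w : Space) (n : ℤ) : ham p k w n = hamFun p k w n := rfl

theorem conj_phase (k : ℝ) : conj (phase k) = phase (-k) := by
  rw [phase, phase, ← Complex.exp_conj]
  simp

theorem phase_eq_cos_add_sin (k : ℝ) :
    phase k = (Real.cos k : ℂ) + (Real.sin k : ℂ) * Complex.I := by
  rw [phase, mul_comm, Complex.exp_mul_I, Complex.ofReal_cos, Complex.ofReal_sin]

theorem summable_mul_conj_mul {a : ℤ → ℂ} {K : ℝ} (ha : ∀ n, ‖a n‖ ≤ K) (u w : Space)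
    (i j : Fin 6) (l m : ℤ) : Summable fun n => a n * (conj (u (n + l) i) * w (n + m) j) := by
  have h := lp.summable_inner (𝕜 := ℂ) ⟨_, memℓp_shift (memℓp_coord u i) l⟩
    ⟨_, memℓp_bdd_mul (memℓp_shift (memℓp_coord w j) m) a K ha⟩
  simpa [mul_assoc, mul_comm, mul_left_comm] using h

theorem ham_isSymmetric (p : Params) (k : ℝ) : (ham p k).IsSymmetric := by
  intro u w
  have hC : ∀ n, ‖(hopC p n : ℂ)‖ ≤ hopBound p := fun n => norm_neg (hopC p n : ℂ) ▸ hopC_norm p n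
  have hD : ∀ n, ‖(hopD p n : ℂ)‖ ≤ hopBound p := fun n => norm_neg (hopD p n : ℂ) ▸ hopD_norm p n
  -- The densities of `⟪H u, w⟫` and `⟪u, H w⟫` differ by a discrete divergence, whose currents
  -- through the bonds of length one and two are `J₁` and `J₂`.
  let J₁ : ℤ → ℂ := fun n =>
    hopC p n * (conj (u (n + 1) 5) * w (n + 0) 0) * phase k
      - hopC p n * (conj (u (n + 0) 0) * w (n + 1) 5) * phase (-k)
      + (hopC p n * (conj (u (n + 1) 3) * w (n + 0) 2)
        - hopC p n * (conj (u (n + 0) 2) * w (n + 1) 3))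
  let J₂ : ℤ → ℂ := fun n =>
    hopD p n * (conj (u (n + 2) 1) * w (n + 0) 4) * phase k
      - hopD p n * (conj (u (n + 0) 4) * w (n + 2) 1) * phase (-k)
  have hJ₁ : Summable J₁ :=
    (((summable_mul_conj_mul hC u w 5 0 1 0).mul_right _).sub
      ((summable_mul_conj_mul hC u w 0 5 0 1).mul_right _)).add
    ((summable_mul_conj_mul hC u w 3 2 1 0).sub (summable_mul_conj_mul hC u w 2 3 0 1))
  have hJ₂ : Summable J₂ :=
    ((summable_mul_conj_mul hD u w 1 4 2 0).mul_right _).sub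
      ((summable_mul_conj_mul hD u w 4 1 0 2).mul_right _)
  have hdiv : ∀ n, inner ℂ (ham p k u n) (w n) - inner ℂ (u n) (ham p k w n) =
      J₁ (n - 1) - J₁ n + (J₂ (n - 2) - J₂ n) := fun n => by
    simp only [PiLp.inner_apply, ham_apply, hamFun, Fin.sum_univ_six, J₁, J₂]
    simp [conj_phase]
    ring
  have hdefect := (lp.hasSum_inner (𝕜 := ℂ) (ham p k u) w).sub
    (lp.hasSum_inner (𝕜 := ℂ) u (ham p k w))
  simp only [hdiv] at hdefect
  refine sub_eq_zero.1 (hdefect.unique ?_)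
  simpa using (hasSum_sub_shift_zero hJ₁ 1).add (hasSum_sub_shift_zero hJ₂ 2)

/-- The Bloch Hamiltonian as a bounded operator; boundedness is automatic for an everywhere defined
symmetric operator. -/
def hamCLM (p : Params) (k : ℝ) : Space →L[ℂ] Space := (ham_isSymmetric p k).toSelfAdjoint

theorem isSelfAdjoint_hamCLM (p : Params) (k : ℝ) : IsSelfAdjoint (hamCLM p k) :=
  (ham_isSymmetric p k).toSelfAdjoint.2

/-- The derivative of the Bloch Hamiltonian at `k = 0`, that is, the coefficient of `sin k` in the
expansion of the Hamiltonian in `1`, `cos k` and `sin k`, which is recovered from the values at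
`0`, `π / 2` and `π`. -/
def hamDeriv (p : Params) : Space →L[ℂ] Space :=
  hamCLM p (Real.pi / 2) - (1 / 2 : ℂ) • (hamCLM p 0 + hamCLM p Real.pi)

theorem hamDeriv_apply (p : Params) (w : Space) (n : ℤ) : hamDeriv p w n =
    !₂[(hopC p n : ℂ) * Complex.I * w (n + 1) 5,
      -(hopD p (n - 2) : ℂ) * Complex.I * w (n - 2) 4, 0, 0,
      (hopD p n : ℂ) * Complex.I * w (n + 2) 1,
      -(hopC p (n - 1) : ℂ) * Complex.I * w (n - 1) 0] := by
  change hamFun p (Real.pi / 2) w n - (1 / 2 : ℂ) • (hamFun p 0 w n + hamFun p Real.pi w n) = _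
  ext j
  fin_cases j <;> simp [hamFun, phase_eq_cos_add_sin] <;> ring

theorem isSelfAdjoint_hamDeriv (p : Params) : IsSelfAdjoint (hamDeriv p) := by
  have hhalf : IsSelfAdjoint (1 / 2 : ℂ) := by simp [isSelfAdjoint_iff]
  exact (isSelfAdjoint_hamCLM p _).sub
    (hhalf.smul ((isSelfAdjoint_hamCLM p _).add (isSelfAdjoint_hamCLM p _)))

theorem hamCLM_sub_sub_eq (p : Params) (k : ℝ) :
    hamCLM p k - hamCLM p 0 - (k : ℂ) • hamDeriv p =
      ((Real.cos k - 1 : ℝ) : ℂ) • ((1 / 2 : ℂ) • (hamCLM p 0 - hamCLM p Real.pi))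
        + ((Real.sin k - k : ℝ) : ℂ) • hamDeriv p := by
  ext w n : 3
  change hamFun p k w n - hamFun p 0 w n - (k : ℂ) • hamDeriv p w n =
    ((Real.cos k - 1 : ℝ) : ℂ) • ((1 / 2 : ℂ) • (hamFun p 0 w n - hamFun p Real.pi w n))
      + ((Real.sin k - k : ℝ) : ℂ) • hamDeriv p w n
  rw [hamDeriv_apply]
  ext j
  fin_cases j <;> simp [hamFun, phase_eq_cos_add_sin] <;> ring

theorem isBigO_hamCLM_sub_sub (p : Params) :
    (fun k => hamCLM p k - hamCLM p 0 - (k : ℂ) • hamDeriv p) =O[𝓝 0] fun k => k ^ 2 := by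
  have hsmul : ∀ {f : ℝ → ℝ} (X : Space →L[ℂ] Space), f =O[𝓝 0] (fun k => k ^ 2) →
      (fun k => (f k : ℂ) • X) =O[𝓝 0] fun k => k ^ 2 := fun X hf => by
    simpa using (Complex.isBigO_ofReal_left.2 hf).smul
      (isBigO_const_const X (one_ne_zero (α := ℝ)) (𝓝 0))
  simp only [hamCLM_sub_sub_eq]
  exact (hsmul _ isBigO_cos_sub_one).add (hsmul _ isBigO_sin_sub_self)

end Operator

section Symmetries

variable {p : Params} {k : ℝ}

/-- The element of `ℓ²(ℤ; ℂ⁶)` with given components. -/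
def ofCoord (f : Fin 6 → ℤ → ℂ) (hf : ∀ j, Memℓp (f j) 2) : Space :=
  ⟨fun n => WithLp.toLp 2 fun j => f j n, (memℓp_iff_coord _).2 hf⟩

@[simp]
theorem ofCoord_apply (f : Fin 6 → ℤ → ℂ) (hf : ∀ j, Memℓp (f j) 2) (n : ℤ) (j : Fin 6) :
    ofCoord f hf n j = f j n := rfl

/-- The chiral symmetry, which changes the sign on the second sublattice (components `4, 5, 6`). -/
def chirality : Space →ₗ[ℂ] Space where
  toFun w := ofCoord (fun j n => ![1, 1, 1, -1, -1, -1] j * w n j) fun j =>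
    memℓp_bdd_mul (memℓp_coord w j) _ 1 fun _ => by fin_cases j <;> simp
  map_add' u w := by ext n j; simp [mul_add]
  map_smul' a w := by ext n j; simp [mul_left_comm]

@[simp]
theorem chirality_apply (w : Space) (n : ℤ) (j : Fin 6) :
    chirality w n j = ![1, 1, 1, -1, -1, -1] j * w n j := rfl

theorem chirality_involutive : Function.Involutive chirality := fun w => by
  ext n j
  fin_cases j <;> simp

theorem ham_chirality (w : Space) : ham p k (chirality w) = (-1 : ℂ) • chirality (ham p k w) := by
  ext n j
  change hamFun p k (chirality w) n j = -1 * chirality (ham p k w) n j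
  fin_cases j <;> simp [ham_apply, hamFun] <;> ring

theorem hasEigenvalue_ham_neg {e : ℂ} (h : Module.End.HasEigenvalue (ham p k) e) :
    Module.End.HasEigenvalue (ham p k) (-e) := by
  simpa using hasEigenvalue_mul_of_forall_apply_eq_smul chirality_involutive.injective
    ham_chirality h

/-- The parameters of the interface reflected about its centre. -/
def Params.mirror (p : Params) : Params := ⟨p.bMinus, p.bPlus, p.δMinus, p.δPlus, p.c⟩

theorem hopB_mirror (p : Params) (n : ℤ) : hopB p.mirror n = hopB p (-1 - n) := by
  simp only [hopB, Params.mirror]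
  split_ifs <;> first | rfl | omega

theorem hopC_mirror (p : Params) (n : ℤ) : hopC p.mirror n = hopC p (-2 - n) := by
  simp only [hopC, Params.mirror]
  split_ifs <;> first | rfl | omega

theorem hopD_mirror (p : Params) (n : ℤ) : hopD p.mirror n = hopD p (-3 - n) := by
  simp only [hopD, Params.mirror]
  split_ifs <;> first | rfl | omega

/-- Reflection about the centre of the interface, which lies between the cells `-1` and `0`; it
exchanges the two sublattices. -/
def mirror : Space →ₗ[ℂ] Space where
  toFun w := ofCoord (fun j n => w (-1 - n) j.rev) fun j =>
    memℓp_two_comp (memℓp_coord w j.rev) (Equiv.subLeft (-1 : ℤ)).injective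
  map_add' _ _ := rfl
  map_smul' _ _ := rfl

@[simp]
theorem mirror_apply (w : Space) (n : ℤ) (j : Fin 6) : mirror w n j = w (-1 - n) j.rev := rfl

theorem mirror_involutive : Function.Involutive mirror := fun w => by
  ext n j
  simp

theorem ham_mirror (w : Space) : ham p.mirror k (mirror w) = mirror (ham p (-k) w) := by
  ext n j
  have hsub : ∀ m : ℤ, -1 - (n + m) = -1 - n - m := fun m => by ring
  have hsub' : ∀ m : ℤ, -1 - (n - m) = -1 - n + m := fun m => by ring
  have hC : -2 - n = -1 - n - 1 := by ring
  have hC' : -2 - (n - 1) = -1 - n := by ring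
  have hD : -3 - n = -1 - n - 2 := by ring
  have hD' : -3 - (n - 2) = -1 - n := by ring
  change hamFun p.mirror k (mirror w) n j = hamFun p (-k) w (-1 - n) j.rev
  fin_cases j <;>
    simp [hamFun, hopB_mirror, hopC_mirror, hopD_mirror, hsub, hsub', hC, hC', hD, hD', Fin.rev] <;>
    ring

theorem hasEigenvalue_ham_of_mirror {e : ℂ}
    (h : Module.End.HasEigenvalue (ham p.mirror (-k)) e) :
    Module.End.HasEigenvalue (ham p k) e := by
  have hcomm : ∀ w, ham p k (mirror w) = (1 : ℂ) • mirror (ham p.mirror (-k) w) := fun w => by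
    rw [one_smul]
    exact ham_mirror (p := p.mirror) w
  simpa using hasEigenvalue_mul_of_forall_apply_eq_smul mirror_involutive.injective hcomm h

end Symmetries

section HalfLine

/-- The `j`-th component of a state on the right half-line. -/
def halfLine (j : Fin 6) : Space →ₗ[ℂ] ℓ²(ℕ, ℂ) where
  toFun w := ⟨fun m => w m j, memℓp_two_comp (memℓp_coord w j) Nat.cast_injective⟩
  map_add' _ _ := rfl
  map_smul' _ _ := rfl

@[simp]
theorem halfLine_apply (j : Fin 6) (w : Space) (m : ℕ) : halfLine j w m = w m j := rfl

theorem norm_sq_eq_sum_halfLine (w : Space) :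
    ‖w‖ ^ 2 = ∑ j, ‖halfLine j w‖ ^ 2 + ∑ j, ‖halfLine j (mirror w)‖ ^ 2 := by
  have hright := hasSum_sum (s := Finset.univ) fun j _ => hasSum_norm_sq (halfLine j w)
  have hleft := hasSum_sum (s := Finset.univ) fun j _ => hasSum_norm_sq (halfLine j (mirror w))
  refine (hasSum_norm_sq w).unique (.of_nat_of_neg_add_one ?_ ?_)
  · simpa [EuclideanSpace.norm_sq_eq] using hright
  · convert hleft using 2 with m
    rw [EuclideanSpace.norm_sq_eq, ← Equiv.sum_comp Fin.revPerm]
    simp [sub_eq_add_neg, add_comm]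

theorem norm_halfLine_le (j : Fin 6) (w : Space) : ‖halfLine j w‖ ≤ ‖w‖ := by
  refine le_of_sq_le_sq ?_ (norm_nonneg w)
  rw [norm_sq_eq_sum_halfLine]
  refine le_add_of_le_of_nonneg ?_ (by positivity)
  exact Finset.single_le_sum (f := fun j => ‖halfLine j w‖ ^ 2) (fun _ _ => by positivity)
    (Finset.mem_univ j)

theorem norm_halfLine_mirror_le (j : Fin 6) (w : Space) : ‖halfLine j (mirror w)‖ ≤ ‖w‖ := by
  refine le_of_sq_le_sq ?_ (norm_nonneg w)
  rw [norm_sq_eq_sum_halfLine]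
  refine le_add_of_nonneg_of_le (by positivity) ?_
  exact Finset.single_le_sum (f := fun j => ‖halfLine j (mirror w)‖ ^ 2) (fun _ _ => by positivity)
    (Finset.mem_univ j)

end HalfLine

section ZeroEnergyRows

variable {p : Params}

/-- The intercell hopping coefficient `a₊ = b₊ + δ₊` in the right half-plane. -/
def Params.aPlus (p : Params) : ℝ := p.bPlus + p.δPlus

/-- The intercell hopping coefficient `a₋ = b₋ + δ₋` in the left half-plane. -/
def Params.aMinus (p : Params) : ℝ := p.bMinus + p.δMinus

/-- All hopping coefficients are positive. -/
structure Params.IsPositive (p : Params) : Prop where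
  bPlus : 0 < p.bPlus
  bMinus : 0 < p.bMinus
  c : 0 < p.c
  aPlus : 0 < p.aPlus
  aMinus : 0 < p.aMinus

theorem Params.IsPositive.mirror (hp : p.IsPositive) : p.mirror.IsPositive :=
  ⟨hp.bMinus, hp.bPlus, hp.c, hp.aMinus, hp.aPlus⟩

theorem hopB_of_nonneg {n : ℤ} (hn : 0 ≤ n) : hopB p n = p.bPlus := if_pos hn

theorem hopC_of_nonneg {n : ℤ} (hn : 0 ≤ n) : hopC p n = p.aPlus := if_pos hn

theorem hopD_of_nonneg {n : ℤ} (hn : 0 ≤ n) : hopD p n = p.aPlus := if_pos hn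

theorem phase_zero : phase 0 = 1 := by simp [phase]

theorem halfLine_zero_ham (w : Space) : halfLine 0 (ham p 0 w) =
    -((p.bPlus : ℂ) • halfLine 3 w + (p.bPlus : ℂ) • halfLine 4 w
      + (p.aPlus : ℂ) • S (halfLine 5 w)) := by
  ext m
  simp only [lp.coeFn_neg, lp.coeFn_add, lp.coeFn_smul, Pi.neg_apply, Pi.add_apply, Pi.smul_apply]
  simp [ham_apply, hamFun, phase_zero, hopB_of_nonneg, hopC_of_nonneg]
  ring

theorem leftShift_leftShift_halfLine_one_ham (w : Space) : S (S (halfLine 1 (ham p 0 w))) =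
    -((p.bPlus : ℂ) • S (S (halfLine 3 w)) + (p.aPlus : ℂ) • halfLine 4 w
      + (p.bPlus : ℂ) • S (S (halfLine 5 w))) := by
  ext m
  have hm : (m : ℤ) + 1 + 1 - 2 = m := by ring
  have hm' : 0 ≤ (m : ℤ) + 1 + 1 := by positivity
  simp only [lp.coeFn_neg, lp.coeFn_add, lp.coeFn_smul, Pi.neg_apply, Pi.add_apply, Pi.smul_apply]
  simp [ham_apply, hamFun, phase_zero, hopB_of_nonneg, hopD_of_nonneg, hm, hm']
  ring

theorem halfLine_two_ham (w : Space) : halfLine 2 (ham p 0 w) =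
    -((p.aPlus : ℂ) • S (halfLine 3 w) + (p.bPlus : ℂ) • halfLine 4 w
      + (p.bPlus : ℂ) • halfLine 5 w) := by
  ext m
  simp only [lp.coeFn_neg, lp.coeFn_add, lp.coeFn_smul, Pi.neg_apply, Pi.add_apply, Pi.smul_apply]
  simp [ham_apply, hamFun, hopB_of_nonneg, hopC_of_nonneg]
  ring

theorem leftShift_halfLine_three_ham (w : Space) : S (halfLine 3 (ham p 0 w)) =
    -((p.bPlus : ℂ) • S (halfLine 0 w) + (p.bPlus : ℂ) • S (halfLine 1 w)
      + (p.aPlus : ℂ) • halfLine 2 w) := by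
  ext m
  have hm : 0 ≤ (m : ℤ) + 1 := by positivity
  simp only [lp.coeFn_neg, lp.coeFn_add, lp.coeFn_smul, Pi.neg_apply, Pi.add_apply, Pi.smul_apply]
  simp [ham_apply, hamFun, hopB_of_nonneg, hopC_of_nonneg, hm]
  ring

theorem halfLine_four_ham (w : Space) : halfLine 4 (ham p 0 w) =
    -((p.bPlus : ℂ) • halfLine 0 w + (p.aPlus : ℂ) • S (S (halfLine 1 w))
      + (p.bPlus : ℂ) • halfLine 2 w) := by
  ext m
  simp only [lp.coeFn_neg, lp.coeFn_add, lp.coeFn_smul, Pi.neg_apply, Pi.add_apply, Pi.smul_apply]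
  simp [ham_apply, hamFun, phase_zero, hopB_of_nonneg, hopD_of_nonneg, add_assoc]
  ring

theorem leftShift_halfLine_five_ham (w : Space) : S (halfLine 5 (ham p 0 w)) =
    -((p.aPlus : ℂ) • halfLine 0 w + (p.bPlus : ℂ) • S (halfLine 1 w)
      + (p.bPlus : ℂ) • S (halfLine 2 w)) := by
  ext m
  have hm : 0 ≤ (m : ℤ) + 1 := by positivity
  simp only [lp.coeFn_neg, lp.coeFn_add, lp.coeFn_smul, Pi.neg_apply, Pi.add_apply, Pi.smul_apply]
  simp [ham_apply, hamFun, phase_zero, hopB_of_nonneg, hopC_of_nonneg, hm]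
  ring

theorem leftShift_halfLine_one (hb : p.bPlus ≠ 0) (w : Space) : S (halfLine 1 w) =
    -((p.bPlus : ℂ)⁻¹ • (S (halfLine 3 (ham p 0 w)) + (p.bPlus : ℂ) • S (halfLine 0 w)
      + (p.aPlus : ℂ) • halfLine 2 w)) := by
  have hb' : (p.bPlus : ℂ) ≠ 0 := Complex.ofReal_ne_zero.2 hb
  rw [leftShift_halfLine_three_ham]
  match_scalars <;> field_simp
  all_goals ring

theorem halfLine_four (hb : p.bPlus ≠ 0) (w : Space) : halfLine 4 w =
    -((p.bPlus : ℂ)⁻¹ • (halfLine 0 (ham p 0 w) + (p.bPlus : ℂ) • halfLine 3 w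
      + (p.aPlus : ℂ) • S (halfLine 5 w))) := by
  have hb' : (p.bPlus : ℂ) ≠ 0 := Complex.ofReal_ne_zero.2 hb
  rw [halfLine_zero_ham]
  match_scalars <;> field_simp
  all_goals ring

theorem leftShift_halfLine_zero_sub_two (hb : p.bPlus ≠ 0) (w : Space) :
    S (halfLine 0 w - halfLine 2 w) - (p.aPlus / p.bPlus : ℂ) • (halfLine 0 w - halfLine 2 w) =
      (p.bPlus : ℂ)⁻¹ • (S (halfLine 5 (ham p 0 w)) - S (halfLine 3 (ham p 0 w))) := by
  have hb' : (p.bPlus : ℂ) ≠ 0 := Complex.ofReal_ne_zero.2 hb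
  rw [leftShift_halfLine_three_ham, leftShift_halfLine_five_ham, map_sub]
  match_scalars <;> field_simp
  ring

theorem leftShift_halfLine_three_sub_five (ha : p.aPlus ≠ 0) (w : Space) :
    S (halfLine 3 w - halfLine 5 w) - (p.bPlus / p.aPlus : ℂ) • (halfLine 3 w - halfLine 5 w) =
      (p.aPlus : ℂ)⁻¹ • (halfLine 0 (ham p 0 w) - halfLine 2 (ham p 0 w)) := by
  have ha' : (p.aPlus : ℂ) ≠ 0 := Complex.ofReal_ne_zero.2 ha
  rw [halfLine_zero_ham, halfLine_two_ham, map_sub]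
  match_scalars <;> field_simp
  ring

variable {ρ σ : ℝ}

theorem leftShift_halfLine_zero_add_two (hb : p.bPlus ≠ 0) (ha : p.aPlus ≠ 0)
    (h : IsBulkRoots p.aPlus p.bPlus ρ σ) (w : Space) :
    S (S (halfLine 0 w + halfLine 2 w)) - (ρ + σ : ℂ) • S (halfLine 0 w + halfLine 2 w)
        + (ρ * σ : ℂ) • (halfLine 0 w + halfLine 2 w) =
      (2 / p.aPlus : ℂ) • halfLine 4 (ham p 0 w)
        - (p.bPlus : ℂ)⁻¹ • S (S (halfLine 3 (ham p 0 w)) + S (halfLine 5 (ham p 0 w))) := by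
  have hb' : (p.bPlus : ℂ) ≠ 0 := Complex.ofReal_ne_zero.2 hb
  have ha' : (p.aPlus : ℂ) ≠ 0 := Complex.ofReal_ne_zero.2 ha
  have hadd : (ρ + σ : ℂ) = -(p.aPlus / p.bPlus) := by
    rw [← neg_div, eq_div_iff hb', mul_comm]
    exact_mod_cast h.add_eq
  have hmul : (ρ * σ : ℂ) = -(2 * p.bPlus / p.aPlus) := by
    rw [← neg_div, ← neg_mul, eq_div_iff ha', mul_comm]
    exact_mod_cast h.mul_eq
  rw [hadd, hmul, leftShift_halfLine_three_ham, leftShift_halfLine_five_ham, halfLine_four_ham]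
  simp only [map_add, map_neg, map_smul]
  match_scalars <;> field_simp
  ring

theorem leftShift_halfLine_three_add_five (hb : p.bPlus ≠ 0) (ha : p.aPlus ≠ 0)
    (h : IsBulkRoots p.aPlus p.bPlus ρ σ) (w : Space) :
    S (S (halfLine 3 w + halfLine 5 w)) - ((ρ : ℂ)⁻¹ + (σ : ℂ)⁻¹) • S (halfLine 3 w + halfLine 5 w)
        + ((ρ : ℂ)⁻¹ * (σ : ℂ)⁻¹) • (halfLine 3 w + halfLine 5 w) =
      (p.aPlus / (2 * p.bPlus ^ 2) : ℂ) • (halfLine 0 (ham p 0 w) + halfLine 2 (ham p 0 w))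
        - (p.bPlus : ℂ)⁻¹ • S (S (halfLine 1 (ham p 0 w))) := by
  have hb' : (p.bPlus : ℂ) ≠ 0 := Complex.ofReal_ne_zero.2 hb
  have ha' : (p.aPlus : ℂ) ≠ 0 := Complex.ofReal_ne_zero.2 ha
  have hρ : (ρ : ℂ) ≠ 0 := Complex.ofReal_ne_zero.2 h.pos.ne'
  have hσ : (σ : ℂ) ≠ 0 := Complex.ofReal_ne_zero.2 (by linarith [h.lt_neg_one])
  have hadd_eq : (p.bPlus * (ρ + σ) : ℂ) = -p.aPlus := mod_cast h.add_eq
  have hmul_eq : (p.aPlus * (ρ * σ) : ℂ) = -2 * p.bPlus := mod_cast h.mul_eq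
  have hmul : ((ρ : ℂ)⁻¹ * (σ : ℂ)⁻¹) = -(p.aPlus / (2 * p.bPlus)) := by
    field_simp
    linear_combination hmul_eq
  have hadd : ((ρ : ℂ)⁻¹ + (σ : ℂ)⁻¹) = p.aPlus ^ 2 / (2 * p.bPlus ^ 2) := by
    field_simp
    linear_combination (2 * p.bPlus : ℂ) * hadd_eq - p.aPlus * hmul_eq
  rw [hadd, hmul, halfLine_zero_ham, halfLine_two_ham, leftShift_leftShift_halfLine_one_ham]
  simp only [map_add]
  match_scalars <;> field_simp
  ring

end ZeroEnergyRows

section BulkEstimate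

variable {p : Params} {W : Type*} {l : Filter W} {v : W → Space} {Q : W → ℝ}

theorem isBigO_halfLine_zero_two (hb : 0 < p.bPlus) (ha : 0 < p.aPlus) (hab : p.aPlus ≠ p.bPlus)
    (hham : ∀ j, (fun w => halfLine j (ham p 0 (v w))) =O[l] Q)
    (h0 : ∀ j, (fun w => halfLine j (v w) 0) =O[l] Q)
    (h1 : ∀ j, (fun w => halfLine j (v w) 1) =O[l] Q) :
    (fun w => halfLine 0 (v w)) =O[l] Q ∧ (fun w => halfLine 2 (v w)) =O[l] Q := by
  obtain ⟨ρ, σ, h⟩ := exists_isBulkRoots ha hb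
  have hquot : ‖(p.aPlus / p.bPlus : ℂ)‖ ≠ 1 := by
    rw [← Complex.ofReal_div, Complex.norm_real, Real.norm_of_nonneg (by positivity)]
    exact (div_eq_one_iff_eq hb.ne').not.2 hab
  refine isBigO_and_isBigO_of_leftShift (h.norm_left_ne_one ha hb hab) h.one_lt_norm_right.ne'
    hquot ?_ ?_ (h0 0) (h0 2) (h1 0) (h1 2)
  · simp only [leftShift_halfLine_zero_add_two hb.ne' ha.ne' h]
    exact (isBigO_fun_const_smul_left (hham 4) _).sub (isBigO_fun_const_smul_left
      (isBigO_leftShift ((isBigO_leftShift (hham 3)).add (isBigO_leftShift (hham 5)))) _)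
  · simp only [leftShift_halfLine_zero_sub_two hb.ne']
    exact isBigO_fun_const_smul_left
      ((isBigO_leftShift (hham 5)).sub (isBigO_leftShift (hham 3))) _

theorem isBigO_halfLine_three_five (hb : 0 < p.bPlus) (ha : 0 < p.aPlus) (hab : p.aPlus ≠ p.bPlus)
    (hham : ∀ j, (fun w => halfLine j (ham p 0 (v w))) =O[l] Q)
    (h0 : ∀ j, (fun w => halfLine j (v w) 0) =O[l] Q)
    (h1 : ∀ j, (fun w => halfLine j (v w) 1) =O[l] Q) :
    (fun w => halfLine 3 (v w)) =O[l] Q ∧ (fun w => halfLine 5 (v w)) =O[l] Q := by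
  obtain ⟨ρ, σ, h⟩ := exists_isBulkRoots ha hb
  have hquot : ‖(p.bPlus / p.aPlus : ℂ)‖ ≠ 1 := by
    rw [← Complex.ofReal_div, Complex.norm_real, Real.norm_of_nonneg (by positivity)]
    exact (div_eq_one_iff_eq ha.ne').not.2 hab.symm
  have hρ : ‖(ρ : ℂ)⁻¹‖ ≠ 1 := by
    rw [norm_inv]
    exact inv_ne_one.2 (h.norm_left_ne_one ha hb hab)
  have hσ : ‖(σ : ℂ)⁻¹‖ ≠ 1 := by
    rw [norm_inv]
    exact inv_ne_one.2 h.one_lt_norm_right.ne'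
  refine isBigO_and_isBigO_of_leftShift hρ hσ hquot ?_ ?_ (h0 3) (h0 5) (h1 3) (h1 5)
  · simp only [leftShift_halfLine_three_add_five hb.ne' ha.ne' h]
    exact (isBigO_fun_const_smul_left ((hham 0).add (hham 2)) _).sub (isBigO_fun_const_smul_left
      (isBigO_leftShift (isBigO_leftShift (hham 1))) _)
  · simp only [leftShift_halfLine_three_sub_five ha.ne']
    exact isBigO_fun_const_smul_left ((hham 0).sub (hham 2)) _

theorem isBigO_halfLine (hb : 0 < p.bPlus) (ha : 0 < p.aPlus) (hab : p.aPlus ≠ p.bPlus)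
    (hham : ∀ j, (fun w => halfLine j (ham p 0 (v w))) =O[l] Q)
    (h0 : ∀ j, (fun w => halfLine j (v w) 0) =O[l] Q)
    (h1 : ∀ j, (fun w => halfLine j (v w) 1) =O[l] Q) (j : Fin 6) :
    (fun w => halfLine j (v w)) =O[l] Q := by
  obtain ⟨hv0, hv2⟩ := isBigO_halfLine_zero_two hb ha hab hham h0 h1
  obtain ⟨hv3, hv5⟩ := isBigO_halfLine_three_five hb ha hab hham h0 h1
  have hv1 : (fun w => halfLine 1 (v w)) =O[l] Q := by
    refine isBigO_of_leftShift_sub_smul (σ := (0 : ℂ)) (by simp) ?_ (h0 1)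
    simp only [zero_smul, sub_zero, leftShift_halfLine_one hb.ne']
    exact (isBigO_fun_const_smul_left (((isBigO_leftShift (hham 3)).add
      (isBigO_fun_const_smul_left (isBigO_leftShift hv0) _)).add
      (isBigO_fun_const_smul_left hv2 _)) _).neg_left
  have hv4 : (fun w => halfLine 4 (v w)) =O[l] Q := by
    simp only [halfLine_four hb.ne']
    exact (isBigO_fun_const_smul_left (((hham 0).add (isBigO_fun_const_smul_left hv3 _)).add
      (isBigO_fun_const_smul_left (isBigO_leftShift hv5) _)) _).neg_left
  fin_cases j
  exacts [hv0, hv1, hv2, hv3, hv4, hv5]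

/-- The restriction of a state to the four cells `-2, -1, 0, 1` around the interface. -/
def window : Space →L[ℂ] Fin 4 → EuclideanSpace ℂ (Fin 6) :=
  .pi fun i => lp.evalCLM ℂ _ 2 ((i : ℤ) - 2)

theorem norm_apply_le_norm_window (w : Space) (i : Fin 4) (j : Fin 6) :
    ‖w ((i : ℤ) - 2) j‖ ≤ ‖window w‖ :=
  (PiLp.norm_apply_le (w ((i : ℤ) - 2)) j).trans (norm_le_pi_norm (window w) i)

theorem exists_antilipschitzWith_hamCLM_zero_prod_window (hp : p.IsPositive)
    (habp : p.aPlus ≠ p.bPlus) (habm : p.aMinus ≠ p.bMinus) :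
    ∃ C, AntilipschitzWith C ((hamCLM p 0).prod window) := by
  set Q : Space → ℝ := fun w => ‖(hamCLM p 0).prod window w‖
  have hhamQ : (hamCLM p 0) =O[⊤] Q := .of_bound' (.of_forall fun w => by
    simp only [Q, norm_norm]
    exact norm_fst_le ((hamCLM p 0).prod window w))
  have hcell : ∀ (i : Fin 4) (j : Fin 6), (fun w : Space => w ((i : ℤ) - 2) j) =O[⊤] Q :=
    fun i j => .of_bound' (.of_forall fun w => by
      simp only [Q, norm_norm]
      exact (norm_apply_le_norm_window w i j).trans
        (norm_snd_le ((hamCLM p 0).prod window w)))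
  have hright : ∀ j, (fun w => halfLine j w) =O[⊤] Q := by
    refine isBigO_halfLine hp.bPlus hp.aPlus habp (fun j => ?_)
      (fun j => hcell 2 j) fun j => hcell 3 j
    exact (IsBigO.of_bound' (.of_forall fun w => norm_halfLine_le j _)).trans hhamQ
  have hleft : ∀ j, (fun w => halfLine j (mirror w)) =O[⊤] Q := by
    refine isBigO_halfLine (p := p.mirror) hp.bMinus hp.aMinus habm (fun j => ?_)
      (fun j => hcell 1 j.rev) fun j => hcell 0 j.rev
    simp only [ham_mirror, neg_zero]
    exact (IsBigO.of_bound' (.of_forall fun w => norm_halfLine_mirror_le j _)).trans hhamQ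
  have hnorm : (fun w : Space => ‖w‖ ^ 2) =O[⊤] fun w => Q w ^ 2 := by
    simp only [norm_sq_eq_sum_halfLine]
    exact (IsBigO.fun_sum fun j _ => (hright j).norm_left.pow 2).add
      (IsBigO.fun_sum fun j _ => (hleft j).norm_left.pow 2)
  obtain ⟨C, hC⟩ := isBigO_top.1 (hnorm.of_pow two_ne_zero)
  refine ⟨C.toNNReal, ((hamCLM p 0).prod window).antilipschitz_of_bound fun w => ?_⟩
  calc
    ‖w‖ ≤ C * Q w := by simpa only [Q, norm_norm] using hC w
    _ ≤ C.toNNReal * Q w := by gcongr; exact Real.le_coe_toNNReal C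

end BulkEstimate

section Kernel

variable {p : Params} {w : Space}

theorem hopB_pos (hp : p.IsPositive) (n : ℤ) : 0 < hopB p n := by
  rw [hopB]
  split_ifs
  exacts [hp.bPlus, hp.bMinus]

theorem hopC_pos (hp : p.IsPositive) (n : ℤ) : 0 < hopC p n := by
  rw [hopC]
  split_ifs
  exacts [hp.aPlus, hp.c, hp.aMinus]

theorem hopD_pos (hp : p.IsPositive) (n : ℤ) : 0 < hopD p n := by
  rw [hopD]
  split_ifs
  exacts [hp.aPlus, hp.c, hp.aMinus]

theorem hamFun_apply_eq_zero {k : ℝ} (hw : ham p k w = 0) (n : ℤ) (j : Fin 6) :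
    hamFun p k w n j = 0 :=
  congrArg (fun v : Space => v n j) hw

theorem hopC_mul_zero_sub_two (hw : ham p 0 w = 0) (n : ℤ) :
    (hopC p n : ℂ) * (w n 0 - w n 2) = hopB p (n + 1) * (w (n + 1) 0 - w (n + 1) 2) := by
  have h3 := hamFun_apply_eq_zero hw (n + 1) 3
  have h5 := hamFun_apply_eq_zero hw (n + 1) 5
  simp only [hamFun, neg_zero, phase_zero, add_sub_cancel_right, Matrix.cons_val] at h3 h5
  linear_combination h3 - h5

theorem hopB_mul_zero_add_two (hw : ham p 0 w = 0) (n : ℤ) :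
    2 * (hopB p n : ℂ) * hopB p (n + 2) * (w n 0 + w n 2) = hopD p n *
      (hopB p (n + 2) * (w (n + 2) 0 + w (n + 2) 2) +
        hopC p (n + 1) * (w (n + 1) 0 + w (n + 1) 2)) := by
  have h3 := hamFun_apply_eq_zero hw (n + 2) 3
  have h4 := hamFun_apply_eq_zero hw n 4
  have h5 := hamFun_apply_eq_zero hw (n + 2) 5
  have hn : n + 2 - 1 = n + 1 := by ring
  simp only [hamFun, neg_zero, phase_zero, hn, Matrix.cons_val] at h3 h4 h5
  linear_combination -2 * (hopB p (n + 2) : ℂ) * h4 + hopD p n * (h3 + h5)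

theorem zero_sub_two_eq_zero (hp : p.IsPositive) (hab : p.bPlus < p.aPlus) (hw : ham p 0 w = 0)
    (n : ℤ) : w n 0 - w n 2 = 0 := by
  have hright : halfLine 0 w - halfLine 2 w = 0 := by
    have hquot : 1 < ‖(p.aPlus / p.bPlus : ℂ)‖ := by
      rw [← Complex.ofReal_div, Complex.norm_real, Real.norm_of_nonneg
        (div_pos hp.aPlus hp.bPlus).le]
      exact (one_lt_div hp.bPlus).2 hab
    refine eq_zero_of_leftShift_eq_smul hquot (sub_eq_zero.1 ?_)
    rw [leftShift_halfLine_zero_sub_two hp.bPlus.ne']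
    simp [hw]
  refine int_induction_two_step_left (P := fun n => w n 0 - w n 2 = 0)
    (fun m => congrArg (fun x => x m) hright) (fun n _ hn _ => ?_) n
  have hrec := hopC_mul_zero_sub_two hw n
  rw [hn, mul_zero] at hrec
  exact (mul_eq_zero.1 hrec).resolve_left (Complex.ofReal_ne_zero.2 (hopC_pos hp n).ne')

theorem zero_add_two_eq_zero_of_halfLine (hp : p.IsPositive) (hw : ham p 0 w = 0)
    (hright : halfLine 0 w + halfLine 2 w = 0) (n : ℤ) : w n 0 + w n 2 = 0 := by
  refine int_induction_two_step_left (P := fun n => w n 0 + w n 2 = 0)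
    (fun m => congrArg (fun x => x m) hright) (fun n _ hn1 hn2 => ?_) n
  have hrec := hopB_mul_zero_add_two hw n
  rw [hn1, hn2, mul_zero, mul_zero, add_zero, mul_zero] at hrec
  refine (mul_eq_zero.1 hrec).resolve_left (mul_ne_zero (mul_ne_zero two_ne_zero ?_) ?_) <;>
    exact Complex.ofReal_ne_zero.2 (hopB_pos hp _).ne'

theorem leftShift_halfLine_zero_add_two_eq_smul (hp : p.IsPositive) {ρ σ : ℝ}
    (h : IsBulkRoots p.aPlus p.bPlus ρ σ) (hw : ham p 0 w = 0) :
    S (halfLine 0 w + halfLine 2 w) = (ρ : ℂ) • (halfLine 0 w + halfLine 2 w) := by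
  refine sub_eq_zero.1 (eq_zero_of_leftShift_eq_smul h.one_lt_norm_right (sub_eq_zero.1 ?_))
  rw [leftShift_factor, add_comm (σ : ℂ), mul_comm (σ : ℂ),
    leftShift_halfLine_zero_add_two hp.bPlus.ne' hp.aPlus.ne' h]
  simp [hw]

theorem halfLine_zero_add_two_eq_zero_of_apply_zero (hp : p.IsPositive) (hw : ham p 0 w = 0)
    (h0 : w 0 0 + w 0 2 = 0) : halfLine 0 w + halfLine 2 w = 0 := by
  obtain ⟨ρ, σ, h⟩ := exists_isBulkRoots hp.aPlus hp.bPlus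
  have hS := leftShift_halfLine_zero_add_two_eq_smul hp h hw
  ext m
  induction m with
  | zero => exact h0
  | succ m ih =>
    have hm : (halfLine 0 w + halfLine 2 w) (m + 1) = (ρ : ℂ) * (halfLine 0 w + halfLine 2 w) m :=
      congrArg (fun x => x m) hS
    rw [hm, ih]
    exact mul_zero _

theorem halfLine_zero_add_two_eq_zero_of_lt (hp : p.IsPositive) (hab : p.aPlus < p.bPlus)
    (hw : ham p 0 w = 0) : halfLine 0 w + halfLine 2 w = 0 := by
  obtain ⟨ρ, σ, h⟩ := exists_isBulkRoots hp.aPlus hp.bPlus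
  refine eq_zero_of_leftShift_eq_smul (σ := (ρ : ℂ)) ?_
    (leftShift_halfLine_zero_add_two_eq_smul hp h hw)
  rw [Complex.norm_real, Real.norm_of_nonneg h.pos.le]
  exact h.one_lt hp.aPlus hab

theorem second_sublattice_eq_zero (hp : p.IsPositive) (hw : ham p 0 w = 0)
    (hsym : ∀ n, w n 3 + w n 5 = 0) (h03 : w 0 3 = 0) (n : ℤ) :
    w n 3 = 0 ∧ w n 4 = 0 ∧ w n 5 = 0 := by
  have hB : ∀ n, (hopB p n : ℂ) ≠ 0 := fun n => Complex.ofReal_ne_zero.2 (hopB_pos hp n).ne'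
  have hC : ∀ n, (hopC p n : ℂ) ≠ 0 := fun n => Complex.ofReal_ne_zero.2 (hopC_pos hp n).ne'
  have h0 := fun n => hamFun_apply_eq_zero hw n 0
  have h2 := fun n => hamFun_apply_eq_zero hw n 2
  simp only [hamFun, neg_zero, phase_zero, Matrix.cons_val] at h0 h2
  have h4 : ∀ n, w n 4 = 0 := fun n => by
    refine (mul_eq_zero.1 ?_).resolve_left (mul_ne_zero two_ne_zero (hB n))
    linear_combination -h0 n - h2 n - (hopB p n : ℂ) * hsym n - hopC p n * hsym (n + 1)
  have hrec : ∀ n, (hopC p n : ℂ) * w (n + 1) 3 = hopB p n * w n 3 := fun n => by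
    linear_combination -h2 n - (hopB p n : ℂ) * (h4 n + hsym n)
  have h3 : w n 3 = 0 := by
    induction n with
    | zero => exact h03
    | succ m ih => simpa [ih, hC] using hrec m
    | pred m ih => simpa [ih, hB] using hrec (-m - 1)
  exact ⟨h3, h4 n, by simpa [h3] using hsym n⟩

theorem eq_zero_of_ham_eq_zero (hp : p.IsPositive) (hright : p.bPlus < p.aPlus)
    (hleft : p.aMinus < p.bMinus) (hw : ham p 0 w = 0) (h00 : w 0 0 = 0) (h03 : w 0 3 = 0) :
    w = 0 := by
  have hmirror : ham p.mirror 0 (mirror w) = 0 := by simp [ham_mirror, hw]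
  have hB : ∀ n, (hopB p n : ℂ) ≠ 0 := fun n => Complex.ofReal_ne_zero.2 (hopB_pos hp n).ne'
  have hanti := zero_sub_two_eq_zero hp hright hw
  have hsym := zero_add_two_eq_zero_of_halfLine hp hw
    (halfLine_zero_add_two_eq_zero_of_apply_zero hp hw (by linear_combination 2 * h00 - hanti 0))
  have hsym' : ∀ n, w n 3 + w n 5 = 0 := fun n => by
    have h := zero_add_two_eq_zero_of_halfLine hp.mirror hmirror
      (halfLine_zero_add_two_eq_zero_of_lt hp.mirror hleft hmirror) (-1 - n)
    simpa [Fin.rev, add_comm] using h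
  have h0 : ∀ n, w n 0 = 0 := fun n => by linear_combination (hsym n + hanti n) / 2
  have h2 : ∀ n, w n 2 = 0 := fun n => by linear_combination (hsym n - hanti n) / 2
  have h1 : ∀ n, w n 1 = 0 := fun n => by
    have h := hamFun_apply_eq_zero hw n 3
    simpa [hamFun, h0, h2, hB] using h
  have hsecond := second_sublattice_eq_zero hp hw hsym' h03
  ext n j
  fin_cases j
  exacts [h0 n, h1 n, h2 n, (hsecond n).1, (hsecond n).2.1, (hsecond n).2.2]

end Kernel

section Modes

variable {p : Params}

theorem hopB_of_neg {n : ℤ} (hn : n < 0) : hopB p n = p.bMinus := if_neg hn.not_ge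

theorem hopC_of_lt {n : ℤ} (hn : n < -1) : hopC p n = p.aMinus :=
  (if_neg (by omega)).trans (if_neg hn.ne)

theorem hopD_of_lt {n : ℤ} (hn : n < -2) : hopD p n = p.aMinus :=
  (if_neg (by omega)).trans (if_neg (by omega))

theorem IsBulkRoots.mul_sq_add_mul {a b ρ σ : ℝ} (h : IsBulkRoots a b ρ σ) :
    a * (b * ρ ^ 2 + a * ρ) = 2 * b ^ 2 := by
  linear_combination a * ρ * h.add_eq - b * h.mul_eq

theorem exists_pos_summable_hopC_mul_eq (hp : p.IsPositive) (hright : p.bPlus < p.aPlus)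
    (hleft : p.aMinus < p.bMinus) :
    ∃ z : ℤ → ℝ, (∀ n, 0 < z n) ∧ Summable z ∧ ∀ n, hopC p n * z (n + 1) = hopB p n * z n := by
  have ha := hp.aPlus
  have hb := hp.bPlus
  obtain ⟨z, hpos, hz, hnat, hrec⟩ := exists_pos_summable_extension_left
    (f := fun m => (p.bPlus / p.aPlus) ^ m) (α := fun n => hopC p n / hopB p n) (β := 0)
    (a := p.aMinus / p.bMinus) (b := 0) (fun m => by positivity)
    (summable_geometric_of_lt_one (by positivity) ((div_lt_one ha).2 hright))
    (fun n => div_pos (hopC_pos hp n) (hopB_pos hp n)) (fun _ => le_rfl)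
    (by simpa using (div_lt_one hp.bMinus).2 hleft)
    ((eventually_lt_atBot (-1)).mono fun n hn => by
      rw [hopB_of_neg (by omega), hopC_of_lt hn]) (.of_forall fun _ => le_rfl)
  refine ⟨z, hpos, hz, fun n => ?_⟩
  obtain hn | hn := lt_or_ge n 0
  · have hB := (hopB_pos hp n).ne'
    rw [hrec n hn, Pi.zero_apply]
    field_simp
    ring
  · lift n to ℕ using hn
    have h1 := hnat (n + 1)
    push_cast at h1
    rw [hopB_of_nonneg n.cast_nonneg, hopC_of_nonneg n.cast_nonneg, hnat, h1, pow_succ]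
    field_simp

theorem exists_pos_summable_two_mul_hopB_mul_eq (hp : p.IsPositive) (hright : p.bPlus < p.aPlus)
    (hleft : p.aMinus < p.bMinus) :
    ∃ x : ℤ → ℝ, (∀ n, 0 < x n) ∧ Summable x ∧ ∀ n, 2 * hopB p n * hopB p (n + 2) * x n =
      hopD p n * (hopB p (n + 2) * x (n + 2) + hopC p (n + 1) * x (n + 1)) := by
  have ha := hp.aMinus
  have hb := hp.bMinus
  obtain ⟨ρ, σ, h⟩ := exists_isBulkRoots hp.aPlus hp.bPlus
  obtain ⟨x, hpos, hx, hnat, hrec⟩ := exists_pos_summable_extension_left (f := (ρ ^ ·))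
    (α := fun n => hopD p n * hopC p (n + 1) / (2 * hopB p n * hopB p (n + 2)))
    (β := fun n => hopD p n / (2 * hopB p n))
    (a := p.aMinus * p.aMinus / (2 * p.bMinus * p.bMinus)) (b := p.aMinus / (2 * p.bMinus))
    (fun m => pow_pos h.pos m)
    (summable_geometric_of_lt_one h.pos.le (h.lt_one hp.bPlus hright))
    (fun n => div_pos (mul_pos (hopD_pos hp n) (hopC_pos hp _))
      (mul_pos (mul_pos two_pos (hopB_pos hp n)) (hopB_pos hp _)))
    (fun n => (div_pos (hopD_pos hp n) (mul_pos two_pos (hopB_pos hp n))).le)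
    (by field_simp; nlinarith)
    ((eventually_lt_atBot (-2)).mono fun n hn => by
      rw [hopB_of_neg (by omega), hopB_of_neg (by omega), hopC_of_lt (by omega), hopD_of_lt hn])
    ((eventually_lt_atBot (-2)).mono fun n hn => by
      rw [hopB_of_neg (by omega), hopD_of_lt hn])
  refine ⟨x, hpos, hx, fun n => ?_⟩
  obtain hn | hn := lt_or_ge n 0
  · have hB := (hopB_pos hp n).ne'
    have hB2 := (hopB_pos hp (n + 2)).ne'
    rw [hrec n hn]
    field_simp
    ring
  · lift n to ℕ using hn
    have h1 := hnat (n + 1)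
    have h2 := hnat (n + 2)
    push_cast at h1 h2
    rw [hopB_of_nonneg n.cast_nonneg, hopB_of_nonneg (by omega), hopC_of_nonneg (by omega),
      hopD_of_nonneg n.cast_nonneg, hnat, h1, h2]
    linear_combination -ρ ^ n * h.mul_sq_add_mul

variable {x z : ℤ → ℂ}

/-- The second component of a zero mode on the first sublattice whose first and third components
are `x`, as determined by the fourth row of the Hamiltonian. -/
def middle (p : Params) (x : ℤ → ℂ) (n : ℤ) : ℂ := -x n - hopC p (n - 1) / hopB p n * x (n - 1)

theorem norm_inv_hopB_le (p : Params) (n : ℤ) :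
    ‖(hopB p n : ℂ)⁻¹‖ ≤ |p.bPlus|⁻¹ + |p.bMinus|⁻¹ := by
  rw [norm_inv, Complex.norm_real, Real.norm_eq_abs, hopB]
  split_ifs
  exacts [le_add_of_nonneg_right (by positivity), le_add_of_nonneg_left (by positivity)]

theorem memℓp_middle (p : Params) (hx : Memℓp x 2) : Memℓp (middle p x) 2 := by
  have h := memℓp_bdd_mul (memℓp_bdd_mul (memℓp_shift hx (-1)) _ _ fun n => hopC_norm p (n - 1))
    _ _ (norm_inv_hopB_le p)
  convert hx.neg.add h using 1
  ext n
  simp only [middle, Pi.add_apply, Pi.neg_apply, ← sub_eq_add_neg]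
  ring

/-- The profile of a zero mode on the first sublattice (components `1, 2, 3`) with equal first and
third components `x`. -/
def modeA (p : Params) (hx : Memℓp x 2) : Space :=
  ofCoord ![x, middle p x, x, 0, 0, 0] fun j => by
    fin_cases j
    exacts [hx, memℓp_middle p hx, hx, zero_memℓp, zero_memℓp, zero_memℓp]

/-- The profile of a zero mode on the second sublattice (components `4, 5, 6`) with opposite fourth
and sixth components `z` and `-z`. -/
def modeB (hz : Memℓp z 2) : Space :=
  ofCoord ![0, 0, 0, z, 0, -z] fun j => by
    fin_cases j
    exacts [zero_memℓp, zero_memℓp, zero_memℓp, hz, zero_memℓp, hz.neg]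

theorem ham_modeA (hb : ∀ n, hopB p n ≠ 0) (hx : Memℓp x 2)
    (hrec : ∀ n, 2 * (hopB p n : ℂ) * hopB p (n + 2) * x n =
      hopD p n * (hopB p (n + 2) * x (n + 2) + hopC p (n + 1) * x (n + 1))) :
    ham p 0 (modeA p hx) = 0 := by
  have hb' : ∀ n, (hopB p n : ℂ) ≠ 0 := fun n => Complex.ofReal_ne_zero.2 (hb n)
  have hmid : ∀ n, (hopB p n : ℂ) * middle p x n = -hopB p n * x n - hopC p (n - 1) * x (n - 1) :=
    fun n => by
      rw [middle]
      field_simp [hb' n]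
  ext n j
  change hamFun p 0 (modeA p hx) n j = 0
  match j with
  | 0 | 1 | 2 => simp [hamFun, modeA]
  | 3 =>
    simp only [hamFun, modeA, ofCoord_apply, Matrix.cons_val]
    linear_combination -hmid n
  | 4 =>
    have hmid2 := hmid (n + 2)
    rw [show n + 2 - 1 = n + 1 by ring] at hmid2
    refine mul_left_cancel₀ (hb' (n + 2)) ?_
    simp only [hamFun, modeA, ofCoord_apply, neg_zero, phase_zero, Matrix.cons_val]
    linear_combination -hopD p n * hmid2 - hrec n
  | 5 =>
    simp only [hamFun, modeA, ofCoord_apply, phase_zero, Matrix.cons_val]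
    linear_combination -hmid n

theorem ham_modeB (hz : Memℓp z 2) (hrec : ∀ n, (hopC p n : ℂ) * z (n + 1) = hopB p n * z n) :
    ham p 0 (modeB hz) = 0 := by
  ext n j
  change hamFun p 0 (modeB hz) n j = 0
  match j with
  | 0 =>
    simp only [hamFun, modeB, ofCoord_apply, neg_zero, phase_zero, Matrix.cons_val, Pi.neg_apply,
      Pi.zero_apply]
    linear_combination hrec n
  | 1 => simp [hamFun, modeB]
  | 2 =>
    simp only [hamFun, modeB, ofCoord_apply, Matrix.cons_val, Pi.neg_apply,
      Pi.zero_apply]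
    linear_combination -hrec n
  | 3 | 4 | 5 => simp [hamFun, modeB]

theorem inner_modeA_modeB (hx : Memℓp x 2) (hz : Memℓp z 2) :
    inner ℂ (modeA p hx) (modeB hz) = 0 := by
  simp [lp.inner_eq_tsum, PiLp.inner_apply, Fin.sum_univ_six, modeA, modeB]

theorem inner_modeA_hamDeriv_modeA (hx : Memℓp x 2) :
    inner ℂ (modeA p hx) (hamDeriv p (modeA p hx)) = 0 := by
  simp [lp.inner_eq_tsum, PiLp.inner_apply, Fin.sum_univ_six, modeA, hamDeriv_apply]

theorem inner_modeB_hamDeriv_modeB (hz : Memℓp z 2) :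
    inner ℂ (modeB hz) (hamDeriv p (modeB hz)) = 0 := by
  simp [lp.inner_eq_tsum, PiLp.inner_apply, Fin.sum_univ_six, modeB, hamDeriv_apply]

theorem hasSum_inner_modeA_hamDeriv_modeB (p : Params) (hx : Memℓp x 2) (hz : Memℓp z 2) :
    HasSum (fun n => -Complex.I * (hopC p n * conj (x n) * z (n + 1)))
      (inner ℂ (modeA p hx) (hamDeriv p (modeB hz))) := by
  have hterm : ∀ n, inner ℂ (modeA p hx n) (hamDeriv p (modeB hz) n) =
      -Complex.I * (hopC p n * conj (x n) * z (n + 1)) := fun n => by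
    simp [PiLp.inner_apply, Fin.sum_univ_six, modeA, modeB, hamDeriv_apply]
    ring
  simpa only [hterm] using lp.hasSum_inner (𝕜 := ℂ) (modeA p hx) (hamDeriv p (modeB hz))

end Modes

section Branch

variable {p : Params}

theorem mem_span_modeA_modeB (hp : p.IsPositive) (hright : p.bPlus < p.aPlus)
    (hleft : p.aMinus < p.bMinus) {x z : ℤ → ℂ} (hx : Memℓp x 2) (hz : Memℓp z 2)
    (hx0 : x 0 ≠ 0) (hz0 : z 0 ≠ 0) (hA : ham p 0 (modeA p hx) = 0) (hB : ham p 0 (modeB hz) = 0)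
    {w : Space} (hw : ham p 0 w = 0) : w ∈ Submodule.span ℂ {modeA p hx, modeB hz} := by
  refine Submodule.mem_span_pair.2 ⟨w 0 0 / x 0, w 0 3 / z 0, (sub_eq_zero.1 ?_).symm⟩
  refine eq_zero_of_ham_eq_zero hp hright hleft ?_ ?_ ?_
  · simp only [map_sub, map_add, map_smul, hA, hB, hw, smul_zero, add_zero, sub_zero]
  · change w 0 0 - (w 0 0 / x 0 * x 0 + w 0 3 / z 0 * 0) = 0
    rw [div_mul_cancel₀ _ hx0, mul_zero, add_zero, sub_self]
  · change w 0 3 - (w 0 0 / x 0 * 0 + w 0 3 / z 0 * z 0) = 0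
    rw [div_mul_cancel₀ _ hz0, mul_zero, zero_add, sub_self]

theorem exists_ker_hamCLM_zero_eq_span_pair (hp : p.IsPositive) (hright : p.bPlus < p.aPlus)
    (hleft : p.aMinus < p.bMinus) :
    ∃ U V : Space, (hamCLM p 0).ker = Submodule.span ℂ {U, V} ∧ inner ℂ U V = 0 ∧
      inner ℂ U (hamDeriv p U) = 0 ∧ inner ℂ V (hamDeriv p V) = 0 ∧
      inner ℂ U (hamDeriv p V) ≠ 0 := by
  obtain ⟨x, hxpos, hxs, hxrec⟩ := exists_pos_summable_two_mul_hopB_mul_eq hp hright hleft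
  obtain ⟨z, hzpos, hzs, hzrec⟩ := exists_pos_summable_hopC_mul_eq hp hright hleft
  have hx : Memℓp (fun n => (x n : ℂ)) 2 := memℓp_two_of_summable_norm (by simpa using hxs.abs)
  have hz : Memℓp (fun n => (z n : ℂ)) 2 := memℓp_two_of_summable_norm (by simpa using hzs.abs)
  have hA := ham_modeA (fun n => (hopB_pos hp n).ne') hx (mod_cast hxrec)
  have hB := ham_modeB hz (mod_cast hzrec)
  refine ⟨modeA p hx, modeB hz, le_antisymm (fun w hw => ?_) (Submodule.span_le.2 ?_),
    inner_modeA_modeB hx hz, inner_modeA_hamDeriv_modeA hx, inner_modeB_hamDeriv_modeB hz,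
    fun h => ?_⟩
  · exact mem_span_modeA_modeB hp hright hleft hx hz (Complex.ofReal_ne_zero.2 (hxpos 0).ne')
      (Complex.ofReal_ne_zero.2 (hzpos 0).ne') hA hB hw
  · rintro w (rfl | rfl)
    exacts [hA, hB]
  · have hpos : ∀ n, 0 < hopC p n * x n * z (n + 1) := fun n =>
      mul_pos (mul_pos (hopC_pos hp n) (hxpos n)) (hzpos _)
    have hsum := (hasSum_inner_modeA_hamDeriv_modeB p hx hz).mul_left Complex.I
    rw [h, mul_zero] at hsum
    have hsum' : HasSum (fun n => hopC p n * x n * z (n + 1)) 0 := by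
      rw [← Complex.hasSum_ofReal]
      simpa [← mul_assoc] using hsum
    exact hsum'.tsum_eq.not_gt (hsum'.summable.tsum_pos (fun n => (hpos n).le) 0 (hpos 0))

theorem exists_ham_eigenvalue_branch_of_lt (hp : p.IsPositive) (hright : p.bPlus < p.aPlus)
    (hleft : p.aMinus < p.bMinus) :
    ∃ μ : ℝ, 0 < μ ∧ ∃ e : ℝ → ℝ,
      (∀ᶠ k in 𝓝 0, Module.End.HasEigenvalue (ham p k) (e k : ℂ)) ∧
      (fun k => e k - μ * k) =O[𝓝 0] fun k => k ^ 2 := by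
  obtain ⟨U, V, hker, hUV, hU, hV, hUTV⟩ := exists_ker_hamCLM_zero_eq_span_pair hp hright hleft
  obtain ⟨C, hC⟩ := exists_antilipschitzWith_hamCLM_zero_prod_window hp hright.ne' hleft.ne
  obtain ⟨w, hw, hw0, hperp⟩ := exists_mem_span_pair_sub_smul_mem_orthogonal
    (ContinuousLinearMap.isSelfAdjoint_iff_isSymmetric.1 (isSelfAdjoint_hamDeriv p)) hUV hU hV hUTV
  rw [← hker] at hw hperp
  have hU0 : U ≠ 0 := by rintro rfl; simp at hUTV
  have hV0 : V ≠ 0 := by rintro rfl; simp at hUTV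
  exact ⟨_, div_pos (norm_pos_iff.2 hUTV) (mul_pos (norm_pos_iff.2 hU0) (norm_pos_iff.2 hV0)),
    exists_eigenvalue_branch (isSelfAdjoint_hamCLM p) (isBigO_hamCLM_sub_sub p) hC hw0 hw hperp⟩

theorem exists_ham_eigenvalue_branch (hp : p.IsPositive) (hδ : p.δPlus * p.δMinus < 0) :
    ∃ μ : ℝ, 0 < μ ∧ ∃ e : ℝ → ℝ,
      (∀ᶠ k in 𝓝 0, Module.End.HasEigenvalue (ham p k) (e k : ℂ)) ∧
      (fun k => e k - μ * k) =O[𝓝 0] fun k => k ^ 2 := by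
  rcases mul_neg_iff.1 hδ with ⟨hplus, hminus⟩ | ⟨hplus, hminus⟩
  · exact exists_ham_eigenvalue_branch_of_lt hp (lt_add_of_pos_right _ hplus)
      (add_lt_of_neg_right _ hminus)
  · obtain ⟨μ, hμ, e, he, hO⟩ := exists_ham_eigenvalue_branch_of_lt hp.mirror
      (lt_add_of_pos_right _ hminus) (add_lt_of_neg_right _ hplus)
    have hneg : Tendsto (fun k : ℝ => -k) (𝓝 0) (𝓝 0) := by
      simpa using (continuous_neg (G := ℝ)).tendsto 0
    refine ⟨μ, hμ, fun k => -e (-k), (hneg.eventually he).mono fun k hk => ?_, ?_⟩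
    · simpa using hasEigenvalue_ham_neg (hasEigenvalue_ham_of_mirror hk)
    · exact (hO.comp_tendsto hneg).neg_left.congr (fun k => by simp; ring) fun k => by simp

end Branch

end TypeII

end

theorem mainTheorem4 (p : TypeII.Params)
    (hbp : 0 < p.bPlus) (hbm : 0 < p.bMinus) (hc : 0 < p.c)
    (hdp : 0 < p.bPlus + p.δPlus) (hdm : 0 < p.bMinus + p.δMinus)
    (hδ : p.δPlus * p.δMinus < 0) :
    ∃ E₁ : ℝ, E₁ ≠ 0 ∧ ∃ Eplus Eminus : ℝ → ℝ,
      (∀ᶠ k in 𝓝[≠] (0 : ℝ),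
        Eminus k ≠ Eplus k ∧
        Module.End.HasEigenvalue (TypeII.ham p k) (Eplus k : ℂ) ∧
        Module.End.HasEigenvalue (TypeII.ham p k) (Eminus k : ℂ)) ∧
      (fun k => Eplus k - E₁ * |k|) =O[𝓝[≠] (0 : ℝ)] (fun k => k ^ 2) ∧
      (fun k => Eminus k - (-(E₁ * |k|))) =O[𝓝[≠] (0 : ℝ)] (fun k => k ^ 2) := by
  obtain ⟨μ, hμ, e, he, hO⟩ := TypeII.exists_ham_eigenvalue_branch ⟨hbp, hbm, hc, hdp, hdm⟩ hδ
  have he' : ∀ᶠ k in 𝓝[≠] 0, Module.End.HasEigenvalue (TypeII.ham p k) ((|e k| : ℝ) : ℂ) :=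
    (he.filter_mono nhdsWithin_le_nhds).mono fun k hk => by
      rcases abs_choice (e k) with h | h <;> rw [h]
      · exact hk
      · simpa using TypeII.hasEigenvalue_ham_neg hk
  have hO' : (fun k => |e k| - μ * |k|) =O[𝓝[≠] 0] fun k => k ^ 2 :=
    .trans (.of_bound' <| .of_forall fun k => by
      simpa [abs_mul, abs_of_pos hμ] using abs_abs_sub_abs_le (e k) (μ * k))
      (hO.mono nhdsWithin_le_nhds)
  refine ⟨μ, hμ.ne', fun k => |e k|, fun k => -|e k|, ?_, hO', ?_⟩
  · filter_upwards [he', eventually_ne_zero_of_sub_mul_isBigO hμ.ne' hO] with k hk hne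
    exact ⟨by simpa [neg_eq_self] using hne, hk, by simpa using TypeII.hasEigenvalue_ham_neg hk⟩
  · exact hO'.neg_left.congr_left fun k => by ring
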